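/- Let $G$ be a finite simple graph with $N$ vertices that is locally reconstructible, i.e. $G$ is connected and its vertices can be partitioned into two non-empty parts such that every vertex is incident with at most one edge crossing the partition. Let $|\psi_G\rangle$ be the graph state of $G$ (one qubit per vertex, prepared in $|+\rangle=(|0\rangle+|1\rangle)/\sqrt2$, with a controlled-phase gate applied along every edge), and for $0\le p\le \tfrac12$ let $$\rho_{G,p}=\sum_{j\in\{0,1\}^N}p^{|j|}(1-p)^{N-|j|}\,Z_j|\psi_G\rangle\langle\psi_G|Z_j$$ be the graph state subject to independent $Z$-errors of probability $p$ on each qubit, where $|j|$ is the number of ones in $j$ and $Z_j$ applies Pauli $Z$ to the qubits $v$ with $j_v=1$. Each qubit is held by a different party, which holds the corresponding qubit of every copy. The state $\rho_{G,p}$ is called purifiable if for every $\varepsilon>0$ there is a protocol of stochastic local operations and classical communication (SLOCC: finitely many rounds of local quantum measurements with finitely many outcomes, each depending on all earlier outcomes, followed by post-selection) which, applied to finitely many copies of $\rho_{G,p}$, succeeds with positive probability and upon success outputs a state of fidelity at least $1-\varepsilon$ with $|\psi_G\rangle$. The Divide and Rebuild Purification Protocol (DRPP) is the following SLOCC protocol.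 For each edge of $G$ take $n$ copies of $\rho_{G,p}$ and measure in the $Z$-basis all qubits not at the ends of that edge, each end then applying $Z$ once for every measured neighbour with result $1$; apply to the resulting $n$ two-qubit states a two-party SLOCC protocol between the two ends, with the aim of obtaining the two-qubit graph state (a Bell pair); finally let each vertex project its qubits, one for each incident edge, onto one qubit by $|0\rangle\langle 0\cdots0|+|1\rangle\langle1\cdots1|$ (post-selected). The DRPP is said to purify $\rho_{G,p}$ if for every $\varepsilon>0$ the number $n$ and the two-party protocols can be chosen such that each two-party protocol, applied to $n$ copies of the two-qubit graph state with independent $Z$-errors of probability $p$, and the whole protocol, applied to copies of $\rho_{G,p}$, succeed with positive probability and then reach their targets with fidelity at least $1-\varepsilon$. Then, for $0\le p\le\tfrac12$: 1. if $(1-p)^2<\tfrac12$, then $\rho_{G,p}$ is not purifiable (by any SLOCC protocol); 2. if $(1-p)^2>\tfrac12$, then the DRPP purifies $\rho_{G,p}$; 3. the threshold probability is $1-1/\sqrt2$: it is the supremum of the $p\in[0,\tfrac12]$ for which $\rho_{G,p}$ is purifiable, and also of those for which the DRPP purifies $\rho_{G,p}$; 4. the initial fidelity is $\langle\psi_G|\rho_{G,p}|\psi_G\rangle=(1-p)^N$,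 and if $f_{\mathrm{threshold}}$ denotes the infimum of the initial fidelities over all $p\in[0,\tfrac12]$ for which $\rho_{G,p}$ is purifiable, and $f_{\mathrm{crit}}$ the infimum over all $p\in[0,\tfrac12]$ for which the DRPP purifies $\rho_{G,p}$, then $$f_{\mathrm{threshold}}=f_{\mathrm{crit}}=2^{-N/2},$$ so the DRPP is optimal. -/

import Mathlib

open scoped Matrix

noncomputable section

/-! ### Stochastic local operations and classical communication

A family of parties `V` shares a finite-dimensional quantum system.  Party `v` holds the Hilbert
space with orthonormal basis indexed by the finite type `d v`; the joint system has the basis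
`∀ v, d v`, and its (unnormalised) states are matrices indexed by `∀ v, d v`. -/

/-- The tensor product, over all parties, of local operators. -/
def tensorOp {V : Type} [Fintype V] {d m : V → Type} (K : ∀ v, Matrix (m v) (d v) ℂ) :
    Matrix (∀ v, m v) (∀ v, d v) ℂ :=
  Matrix.of fun y x => ∏ v, K v (y v) (x v)

/-- One round of local operations: every party `v` performs a quantum measurement with Kraus
operators `kraus v o`, where `o` ranges over the finitely many outcomes of that party.  The local
systems change from `d` to `m` (so ancillas may be added and subsystems may be discarded). -/
structure LocalRound {V : Type} (d m : V → Type) [∀ v, Fintype (m v)] where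
  /-- the outcomes of each party -/
  Outcome : V → Type
  /-- there are finitely many outcomes -/
  finOutcome : ∀ v, Fintype (Outcome v)
  /-- the Kraus operators -/
  kraus : ∀ v, Outcome v → Matrix (m v) (d v) ℂ
  /-- the Kraus operators of each party form a complete measurement -/
  complete : ∀ v [DecidableEq (d v)], ∑ o, (kraus v o)ᴴ * kraus v o = 1

attribute [instance] LocalRound.finOutcome

/-- `SLOCC e r d` is the type of stochastic LOCC protocols that start from the local systems `d`,
end with the local systems `e`, and use `r + 1` rounds of local operations.  After each round all
outcomes are broadcast, so that everything done later (including the later choice of local systems)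
may depend on all earlier outcomes.  After the last round the parties decide, depending on all
outcomes, whether the run is accepted. -/
inductive SLOCC {V : Type} (e : V → Type) [∀ v, Fintype (e v)] : ℕ → (V → Type) → Type 1
  | last {d : V → Type} (R : LocalRound d e) (accept : (∀ v, R.Outcome v) → Bool) : SLOCC e 0 d
  | step {r : ℕ} {d : V → Type} (m : V → Type) (finMid : ∀ v, Fintype (m v))
      (R : LocalRound d m) (next : (∀ v, R.Outcome v) → SLOCC e r m) : SLOCC e (r + 1) d

namespace SLOCC

/-- The unnormalised output of a protocol: the sum of the post-measurement states over all accepted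
runs.  Its trace is the probability of acceptance. -/
def apply {V : Type} [Fintype V] [DecidableEq V] {e : V → Type} [∀ v, Fintype (e v)] :
    {r : ℕ} → {d : V → Type} → [∀ v, Fintype (d v)] → SLOCC e r d →
      Matrix (∀ v, d v) (∀ v, d v) ℂ → Matrix (∀ v, e v) (∀ v, e v) ℂ
  | _, _, _, last R accept, ρ =>
      ∑ o : ∀ v, R.Outcome v,
        if accept o then
          tensorOp (fun v => R.kraus v (o v)) * ρ * (tensorOp fun v => R.kraus v (o v))ᴴ
        else 0
  | _, _, _, step _ _ R next, ρ =>
      ∑ o : ∀ v, R.Outcome v,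
        (next o).apply
          (tensorOp (fun v => R.kraus v (o v)) * ρ * (tensorOp fun v => R.kraus v (o v))ᴴ)

section Destructors

variable {V : Type} {e : V → Type} [∀ v, Fintype (e v)] {r : ℕ} {d : V → Type}

/-- The only round of a one-round protocol. -/
def lastRound : SLOCC e 0 d → LocalRound d e
  | last R _ => R

/-- The acceptance rule of a one-round protocol. -/
def lastAccept : (P : SLOCC e 0 d) → (∀ v, P.lastRound.Outcome v) → Bool
  | last _ accept => accept

/-- The local systems after the first of several rounds. -/
def mid : SLOCC e (r + 1) d → V → Type
  | step m _ _ _ => m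

instance finMid : (P : SLOCC e (r + 1) d) → ∀ v, Fintype (P.mid v)
  | step _ finMid _ _ => finMid

/-- The first of several rounds. -/
def firstRound : (P : SLOCC e (r + 1) d) → LocalRound d P.mid
  | step _ _ R _ => R

/-- The rest of the protocol after the first of several rounds. -/
def next : (P : SLOCC e (r + 1) d) → (∀ v, P.firstRound.Outcome v) → SLOCC e r P.mid
  | step _ _ _ next => next

end Destructors

end SLOCC

/-! ### Running protocols of subsets of the parties in parallel

`I v j` says that party `v` takes part in the `j`-th subprotocol.  The parties of the `j`-th
subprotocol are `{v // I v j}`; altogether party `v` holds one local system for each subprotocol in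
which it takes part. -/

section Parallel

variable {V J : Type} [Fintype J] [DecidableEq J] (I : V → J → Prop) [∀ v j, Decidable (I v j)]

/-- Rounds of the subprotocols carried out simultaneously. -/
def parRound {d m : ∀ j, {v // I v j} → Type} [∀ j v, Fintype (m j v)]
    (R : ∀ j, LocalRound (d j) (m j)) :
    LocalRound (fun v => ∀ j : {j // I v j}, d j.1 ⟨v, j.2⟩)
      (fun v => ∀ j : {j // I v j}, m j.1 ⟨v, j.2⟩) where
  Outcome v := ∀ j : {j // I v j}, (R j.1).Outcome ⟨v, j.2⟩
  finOutcome _ := inferInstance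
  kraus v o := Matrix.of fun y x =>
    ∏ j : {j // I v j}, (R j.1).kraus ⟨v, j.2⟩ (o j) (y j) (x j)
  complete v _ := by
    classical
    have h : ∀ (j : {j // I v j}) (x x' : d j.1 ⟨v, j.2⟩),
        ∑ o, ∑ y, star ((R j.1).kraus ⟨v, j.2⟩ o y x) * (R j.1).kraus ⟨v, j.2⟩ o y x'
          = if x = x' then 1 else 0 := by
      intro j x x'
      have := congrFun (congrFun ((R j.1).complete ⟨v, j.2⟩) x) x'
      rw [Matrix.sum_apply, Matrix.one_apply] at this
      simpa [Matrix.mul_apply] using this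
    ext x x'
    rw [Matrix.sum_apply, Matrix.one_apply]
    simp only [Matrix.mul_apply, Matrix.conjTranspose_apply, Matrix.of_apply, star_prod,
      ← Finset.prod_mul_distrib]
    have h2 := Fintype.prod_congr _ _ fun j : {j // I v j} => h j (x j) (x' j)
    have h3 : (∏ j : {j // I v j}, if x j = x' j then (1 : ℂ) else 0) = if x = x' then 1 else 0 := by
      rw [Finset.prod_ite_zero]
      simp [funext_iff]
    rw [h3] at h2
    rw [← h2, Fintype.prod_sum]
    refine Finset.sum_congr rfl fun o _ => ?_
    rw [Fintype.prod_sum]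

/-- Run all subprotocols `B j` in parallel, then one final round `R`; accept if all subprotocols
accept and the outcomes of the final round are accepted by `acc`. -/
def parThen {m : ∀ j, {v // I v j} → Type} [∀ j v, Fintype (m j v)]
    {e : V → Type} [∀ v, Fintype (e v)]
    (R : LocalRound (fun v => ∀ j : {j // I v j}, m j.1 ⟨v, j.2⟩) e)
    (acc : (∀ v, R.Outcome v) → Bool) :
    (r : ℕ) → {d : ∀ j, {v // I v j} → Type} → (∀ j, SLOCC (m j) r (d j)) →
      SLOCC e (r + 1) (fun v => ∀ j : {j // I v j}, d j.1 ⟨v, j.2⟩)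
  | 0, _, B =>
      .step _ inferInstance (parRound I fun j => (B j).lastRound) fun o =>
        .last R fun o' =>
          decide (∀ j, (B j).lastAccept (fun v => o v.1 ⟨j, v.2⟩) = true) && acc o'
  | r + 1, _, B =>
      .step _ inferInstance (parRound I fun j => (B j).firstRound) fun o =>
        parThen R acc r fun j => (B j).next fun v => o v.1 ⟨j, v.2⟩

end Parallel

/-! ### Graph states, local `Z`-noise and purification -/

/-- The phase `(-1)^b` of a bit. -/
def bitSign (b : ZMod 2) : ℂ := if b = 0 then 1 else -1

/-- The joint system in which each party holds one qubit. -/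
abbrev Qubits (V : Type) : V → Type := fun _ => ZMod 2

/-- The joint system in which each party holds one qubit of each of the copies labelled by `C`. -/
abbrev Copies (V C : Type) : V → Type := fun _ => C → ZMod 2

section GraphState

variable {V : Type} [Fintype V] [DecidableEq V]

/-- The graph state: all qubits are prepared in `|+⟩`, then a controlled-phase gate is applied along
each edge. -/
def graphState (G : SimpleGraph V) [DecidableRel G.Adj] : (∀ v, Qubits V v) → ℂ := fun x =>
  (∏ _v : V, ((1 / √2 : ℝ) : ℂ)) * ∏ e ∈ G.edgeFinset, if ∀ v ∈ e, x v = 1 then -1 else 1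

/-- The state obtained by applying Pauli `Z` to those qubits `v` for which `j v = 1`. -/
def zRotate (j : V → ZMod 2) (ψ : (∀ v, Qubits V v) → ℂ) : (∀ v, Qubits V v) → ℂ := fun x =>
  (∏ v, bitSign (j v * x v)) * ψ x

/-- The probability that independent errors, each of probability `p`, occur exactly on the qubits
`v` with `j v = 1`. -/
def errorProb (p : ℝ) (j : V → ZMod 2) : ℝ := ∏ v, if j v = 1 then p else 1 - p

/-- The graph state subject to independent local `Z`-errors of probability `p`. -/
def noisyGraphState (G : SimpleGraph V) [DecidableRel G.Adj] (p : ℝ) :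
    Matrix (∀ v, Qubits V v) (∀ v, Qubits V v) ℂ :=
  ∑ j : V → ZMod 2, (errorProb p j : ℂ) •
    Matrix.vecMulVec (zRotate j (graphState G)) (star (zRotate j (graphState G)))

/-- Identical copies of a multi-qubit state, labelled by `C`; party `v` holds the `v`-th qubit of
every copy. -/
def copies (C : Type) [Fintype C] (ρ : Matrix (∀ v, Qubits V v) (∀ v, Qubits V v) ℂ) :
    Matrix (∀ v, Copies V C v) (∀ v, Copies V C v) ℂ :=
  Matrix.of fun x y => ∏ c : C, ρ (fun v => x v c) (fun v => y v c)

/-- The fidelity with the pure state `ψ` of the normalisation of `σ`. -/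
def fidelity (ψ : (∀ v, Qubits V v) → ℂ) (σ : Matrix (∀ v, Qubits V v) (∀ v, Qubits V v) ℂ) : ℝ :=
  (star ψ ⬝ᵥ (σ *ᵥ ψ)).re / σ.trace.re

/-- The protocol, applied to copies of the noisy graph state, succeeds with positive probability,
and upon success yields the pure graph state with fidelity at least `1 - ε`. -/
def ReachesFidelity (G : SimpleGraph V) [DecidableRel G.Adj] (p ε : ℝ) {C : Type} [Fintype C]
    [DecidableEq C] {r : ℕ} (P : SLOCC (Qubits V) r (Copies V C)) : Prop :=
  0 < (P.apply (copies C (noisyGraphState G p))).trace.re ∧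
    1 - ε ≤ fidelity (graphState G) (P.apply (copies C (noisyGraphState G p)))

/-- The noisy graph state can be purified: from finitely many copies some stochastic LOCC protocol
produces the pure graph state with fidelity arbitrarily close to one. -/
def Purifiable (G : SimpleGraph V) [DecidableRel G.Adj] (p : ℝ) : Prop :=
  ∀ ε > 0, ∃ (C : Type) (_ : Fintype C) (_ : DecidableEq C) (r : ℕ)
    (P : SLOCC (Qubits V) r (Copies V C)), ReachesFidelity G p ε P

/-- A graph is locally reconstructible if it is connected and its vertices can be partitioned into
two non-empty parts such that each vertex is on at most one edge crossing the partition. -/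
def IsLocallyReconstructible (G : SimpleGraph V) : Prop :=
  G.Connected ∧ ∃ A : Set V, A.Nonempty ∧ Aᶜ.Nonempty ∧
    ∀ v, {w | G.Adj v w ∧ ¬ (v ∈ A ↔ w ∈ A)}.Subsingleton

/-! ### The Divide and Rebuild Purification Protocol -/

/-- Party `v` takes part in the treatment of the edge `j` if it is one of its two ends. -/
abbrev Incident (G : SimpleGraph V) (v : V) (j : G.edgeSet) : Prop := v ∈ (j : Sym2 V)

/-- The local systems when each of the parties at the ends of each edge `j` holds a system `X`. -/
abbrev EdgeSystems (G : SimpleGraph V) (X : Type) : V → Type :=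
  fun v => ∀ _j : {j // Incident G v j}, X

variable (G : SimpleGraph V) [DecidableRel G.Adj]

/-- Divide: there are `n` copies of the noisy graph state for each edge `j`, and in these all qubits
that are not at an end of `j` are measured in the `Z`-basis. -/
def divideRound (n : ℕ) :
    LocalRound (Copies V (G.edgeSet × Fin n)) (EdgeSystems G (Fin n → ZMod 2)) where
  Outcome v := {j // ¬ Incident G v j} → Fin n → ZMod 2
  finOutcome _ := inferInstance
  kraus v o := Matrix.of fun y x =>
    if (fun (j : {j // Incident G v j}) i => x (j.1, i)) = y ∧
      (fun (j : {j // ¬ Incident G v j}) i => x (j.1, i)) = o then 1 else 0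
  complete v _ := by
    ext x x'
    rw [Matrix.sum_apply, Matrix.one_apply]
    simp only [Matrix.mul_apply, Matrix.conjTranspose_apply, Matrix.of_apply]
    simp only [ite_and, apply_ite star, star_one, star_zero, ite_mul, one_mul, zero_mul,
      Finset.sum_ite_eq, Finset.mem_univ, if_true]
    rw [← ite_and]
    refine if_congr ⟨?_, ?_⟩ rfl rfl
    · rintro ⟨h1, h2⟩
      funext ⟨j, i⟩
      by_cases hj : Incident G v j
      · exact (congrFun (congrFun h1 ⟨j, hj⟩) i).symm
      · exact (congrFun (congrFun h2 ⟨j, hj⟩) i).symm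
    · rintro rfl
      exact ⟨rfl, rfl⟩

/-- Depending on the announced results `o` of the `Z`-measurements, party `v` applies `Z` to its
qubit of the `i`-th copy for the edge `j` once for each neighbour whose qubit of that copy was
measured with result `1`. -/
def correctRound (n : ℕ) (o : ∀ v, (divideRound G n).Outcome v) :
    LocalRound (EdgeSystems G (Fin n → ZMod 2)) (EdgeSystems G (Fin n → ZMod 2)) where
  Outcome _ := Unit
  finOutcome _ := inferInstance
  kraus v _ := Matrix.diagonal fun x => ∏ j : {j // Incident G v j}, ∏ i : Fin n,
    bitSign (x j i * ∑ w : V,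
      if h : G.Adj v w ∧ ¬ Incident G w j.1 then o w ⟨j.1, h.2⟩ i else 0)
  complete v _ := by
    have hs : ∀ b, star (bitSign b) * bitSign b = 1 := by
      intro b; unfold bitSign; split <;> simp
    simp only [Matrix.diagonal_conjTranspose, Matrix.diagonal_mul_diagonal, Pi.star_apply,
      star_prod, ← Finset.prod_mul_distrib, hs, Finset.prod_const_one]
    ext x x'
    simp [Matrix.one_apply]

/-- Rebuild: party `v` holds one qubit for each edge at `v`, and projects these qubits onto a single
qubit.  The outcome `t = 0` is the operation `(|0⟩⟨0…0| + |1⟩⟨1…1|) / √2`; in general the outcome `t`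
is `(|0⟩⟨t| + |1⟩⟨t ⊕ 1…1|) / √2`. -/
def rebuildRound : LocalRound (EdgeSystems G (ZMod 2)) (Qubits V) where
  Outcome v := {j // Incident G v j} → ZMod 2
  finOutcome _ := inferInstance
  kraus v t := Matrix.of fun b x => if x = (fun j => t j + b) then ((1 / √2 : ℝ) : ℂ) else 0
  complete v _ := by
    ext x x'
    rw [Matrix.sum_apply, Matrix.one_apply]
    simp only [Matrix.mul_apply, Matrix.conjTranspose_apply, Matrix.of_apply]
    rw [Finset.sum_comm]
    have hx : ∀ (b : ZMod 2) (x t : {j // Incident G v j} → ZMod 2),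
        (x = fun j => t j + b) ↔ t = fun j => x j - b := by
      intro b x t
      constructor
      · rintro rfl; funext j; simp
      · rintro rfl; funext j; simp
    have h2 : ((√2 : ℝ) : ℂ) * ((√2 : ℝ) : ℂ) = 2 := by
      rw [← Complex.ofReal_mul, Real.mul_self_sqrt (by norm_num)]; norm_num
    have h3 : ((√2 : ℝ) : ℂ) ≠ 0 := by
      intro h; rw [h] at h2; norm_num at h2
    have hsum : ∀ b : ZMod 2, (∑ t : {j // Incident G v j} → ZMod 2,
        star (if x = (fun j => t j + b) then ((1 / √2 : ℝ) : ℂ) else 0) *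
          (if x' = (fun j => t j + b) then ((1 / √2 : ℝ) : ℂ) else 0))
        = if x = x' then 1 / 2 else 0 := by
      intro b
      simp only [hx, apply_ite star, star_zero, ite_mul, zero_mul, Finset.sum_ite_eq',
        Finset.mem_univ, if_true]
      have he : ((fun j => x j - b) = fun j => x' j - b) ↔ x = x' := by
        simp [funext_iff]
      simp only [he]
      split
      · simp only [one_div, Complex.ofReal_inv, RCLike.star_def, map_inv₀, Complex.conj_ofReal]
        rw [← mul_inv, h2]
      · simp
    trans ∑ _b : ZMod 2, if x = x' then (1 / 2 : ℂ) else 0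
    · exact Finset.sum_congr rfl fun b _ => by convert hsum b
    simp only [Finset.sum_const, Finset.card_univ, ZMod.card]
    split <;> simp

/-- The Divide and Rebuild Purification Protocol.  Copies of the noisy graph state are reduced by
`Z`-measurements (and the resulting corrections) to `n` noisy two-qubit states for each edge; for
each edge `j` the two parties at its ends apply to these a two-party protocol `B j`, with the aim of
obtaining a Bell pair; finally the graph state is rebuilt from the pairs.  A run is accepted if all
`B j` accept and each projection has the outcome `|0⟩⟨0…0| + |1⟩⟨1…1|`. -/
def DRPP {n r : ℕ}
    (B : ∀ j : G.edgeSet,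
      SLOCC (Qubits {v // Incident G v j}) r (Copies {v // Incident G v j} (Fin n))) :
    SLOCC (Qubits V) (r + 1 + 1 + 1) (Copies V (G.edgeSet × Fin n)) :=
  .step _ inferInstance (divideRound G n) fun o =>
    .step _ inferInstance (correctRound G n o) fun _ =>
      parThen (Incident G) (rebuildRound G) (fun (t : ∀ v, {j // Incident G v j} → ZMod 2) => decide (∀ v j, t v j = 0)) r B

/-- The Divide and Rebuild Purification Protocol purifies the noisy graph state: for each `ε > 0`
there are two-party protocols which purify the noisy two-qubit graph states at the edges up to `ε`,
and such that the resulting protocol purifies the noisy graph state up to `ε`. -/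
def DRPPPurifies (p : ℝ) : Prop :=
  ∀ ε > 0, ∃ (n r : ℕ) (B : ∀ j : G.edgeSet,
      SLOCC (Qubits {v // Incident G v j}) r (Copies {v // Incident G v j} (Fin n))),
    (∀ j, ReachesFidelity (⊤ : SimpleGraph {v // Incident G v j}) p ε (B j)) ∧
      ReachesFidelity G p ε (DRPP G B)

/-- The fidelity of the noisy graph state itself. -/
def initialFidelity (p : ℝ) : ℝ := fidelity (graphState G) (noisyGraphState G p)

/-- The threshold fidelity for local `Z`-noise: the largest value such that no noisy state of smaller
initial fidelity can be purified by any protocol.  The error probability ranges over `[0, 1/2]`, so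
that the error-free component is the largest one. -/
def fThreshold : ℝ :=
  sInf {f | ∃ p ∈ Set.Icc (0 : ℝ) (1 / 2), Purifiable G p ∧ f = initialFidelity G p}

/-- The critical fidelity of the Divide and Rebuild Purification Protocol for local `Z`-noise: the
largest value such that no noisy state of smaller initial fidelity is purified by it. -/
def fCrit : ℝ :=
  sInf {f | ∃ p ∈ Set.Icc (0 : ℝ) (1 / 2), DRPPPurifies G p ∧ f = initialFidelity G p}

end GraphState

end

noncomputable section

open scoped ComplexOrder

/-! ### Signs -/

/-! Put `q = 1 - 2p`, so that `(1-p)^2 ≤ 1/2` means `(1+q)^2 ≤ 2`. Independent `Z`-noise multiplies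
the entry `(x, y)` of the graph state by `q` for every vertex where `x` and `y` differ
(`noisyGraphState_eq_dephased`). All states met below belong to this family of dephased graph
states, whose fidelity is `∏ (1 + q v) / 2`.

Impossibility rests on the partial transpose over the part `A` of the partition. Up to a diagonal
sign conjugation, it turns the noisy state into a kernel in `x + y` that acquires the sign of the
crossing edges. These edges form a matching, so the kernel is a product of kernels on one or two
bits. The kernel of a crossing edge has Fourier coefficients proportional to `1 + 2q - q²`, `1 + q²`
and `1 - 2q - q²`; they are non-negative below the threshold, and the whole partial transpose is
then positive (`posSemidef_partialTranspose_noisy`). Positivity survives taking copies and every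
SLOCC protocol (`SLOCC.partialTranspose_posSemidef`). Since the partial transpose of the pure graph
state is at most `1/2` as an operator, such outputs have fidelity at most `1/2`
(`expectation_le_of_partialTranspose_posSemidef`).

Achievability rests on error detection. The ends of an edge project their `n` qubits onto cosets of
two mutually orthogonal codes. There the `n` controlled-phase signs reduce to a single one between
the encoded bits, and the only surviving errors are those orthogonal to the code. With `n = 2m + 1`
and random codes of dimension `m`, the undetected nonzero errors have mean probability at most
`2^(-m)`, whereas no error occurs with probability `(1-p)^(2m+1)`. The ratio tends to zero exactly
when `(1-p)^2 > 1/2` (`exists_codes`). In the rebuilt state the dampings of the edges at a vertex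
multiply (`conj_drppKraus`), so the global fidelity also tends to one.

A state purified by the DRPP is purifiable, so both properties share the threshold `1 - 1/√2`; the
fidelities follow from `(1-p)^N`. -/

theorem bitSign_zero : bitSign 0 = 1 := by simp [bitSign]

theorem bitSign_one : bitSign 1 = -1 := by simp [bitSign]

theorem zmod_two_cases (b : ZMod 2) : b = 0 ∨ b = 1 := by
  revert b; decide

theorem bitSign_add (a b : ZMod 2) : bitSign (a + b) = bitSign a * bitSign b := by
  have h : (1 : ZMod 2) + 1 = 0 := by decide
  rcases zmod_two_cases a with rfl | rfl <;> rcases zmod_two_cases b with rfl | rfl <;>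
    simp [bitSign, h]

theorem bitSign_sum {ι : Type*} (s : Finset ι) (f : ι → ZMod 2) :
    bitSign (∑ i ∈ s, f i) = ∏ i ∈ s, bitSign (f i) := by
  classical
  induction s using Finset.induction_on with
  | empty => simp [bitSign_zero]
  | insert i s hi ih => rw [Finset.sum_insert hi, Finset.prod_insert hi, bitSign_add, ih]

theorem bitSign_mul_self (b : ZMod 2) : bitSign b * bitSign b = 1 := by
  unfold bitSign; split <;> simp

theorem star_bitSign (b : ZMod 2) : star (bitSign b) = bitSign b := by
  unfold bitSign; split <;> simp

theorem sum_zmod_two {M : Type*} [AddCommMonoid M] (f : ZMod 2 → M) : ∑ b, f b = f 0 + f 1 :=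
  Fin.sum_univ_two f

theorem zmod_two_add_eq_zero_iff (a b : ZMod 2) : a + b = 0 ↔ a = b := by
  revert a b; decide

/-- The sign contributed by the controlled-phase gate along `e`. -/
def edgeSign {V : Type} [DecidableEq V] (e : Sym2 V) (x : V → ZMod 2) : ℂ :=
  open Classical in if ∀ v ∈ e, x v = 1 then -1 else 1

theorem edgeSign_mk {V : Type} [DecidableEq V] (a b : V) (x : V → ZMod 2) :
    edgeSign s(a, b) x = bitSign (x a * x b) := by
  unfold edgeSign
  have : (∀ v ∈ s(a, b), x v = 1) ↔ x a = 1 ∧ x b = 1 := by simp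
  simp only [this]
  rcases zmod_two_cases (x a) with h | h <;> rcases zmod_two_cases (x b) with h' | h' <;>
    simp [h, h', bitSign]

theorem edgeSign_mul_self {V : Type} [DecidableEq V] (e : Sym2 V) (x : V → ZMod 2) :
    edgeSign e x * edgeSign e x = 1 := by
  induction e using Sym2.ind with
  | _ a b => rw [edgeSign_mk, bitSign_mul_self]

theorem star_edgeSign {V : Type} [DecidableEq V] (e : Sym2 V) (x : V → ZMod 2) :
    star (edgeSign e x) = edgeSign e x := by
  induction e using Sym2.ind with
  | _ a b => rw [edgeSign_mk, star_bitSign]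

/-! ### Tensor products of local operators -/

section Tensor

variable {V : Type} [Fintype V]

theorem tensorOp_apply {d m : V → Type} (K : ∀ v, Matrix (m v) (d v) ℂ) (y : ∀ v, m v)
    (x : ∀ v, d v) : tensorOp K y x = ∏ v, K v (y v) (x v) := rfl

theorem tensorOp_mul [DecidableEq V] {d m e : V → Type} [∀ v, Fintype (m v)]
    (K : ∀ v, Matrix (e v) (m v) ℂ) (L : ∀ v, Matrix (m v) (d v) ℂ) :
    tensorOp K * tensorOp L = tensorOp fun v => K v * L v := by
  ext y x
  simp only [Matrix.mul_apply, tensorOp_apply, ← Finset.prod_mul_distrib]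
  rw [Fintype.prod_sum]

theorem conj_apply {m n : Type*} [Fintype n] (T : Matrix m n ℂ) (ρ : Matrix n n ℂ) (x y : m) :
    (T * ρ * Tᴴ) x y = ∑ X, ∑ Y, T x X * ρ X Y * star (T y Y) := by
  simp only [Matrix.mul_apply, Matrix.conjTranspose_apply, Finset.sum_mul]
  rw [Finset.sum_comm]

end Tensor

/-! ### Dephased graph states -/

section Dephased

variable {V : Type} [Fintype V] [DecidableEq V] (G : SimpleGraph V) [DecidableRel G.Adj]

/-- The product of the signs of all controlled-phase gates. -/
def graphSign (x : V → ZMod 2) : ℂ := ∏ e ∈ G.edgeFinset, edgeSign e x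

theorem graphSign_mul_self (x : V → ZMod 2) : graphSign G x * graphSign G x = 1 := by
  simp [graphSign, ← Finset.prod_mul_distrib, edgeSign_mul_self]

theorem star_graphSign (x : V → ZMod 2) : star (graphSign G x) = graphSign G x := by
  simp only [graphSign, star_prod, star_edgeSign]

theorem graphState_eq (x : V → ZMod 2) :
    graphState G x = (((1 / √2 : ℝ) : ℂ) ^ Fintype.card V) * graphSign G x := by
  unfold graphState graphSign edgeSign
  rw [Finset.prod_const, Finset.card_univ]
  congr 1
  refine Finset.prod_congr rfl fun e _ => ?_
  congr

theorem star_graphState (x : V → ZMod 2) : star (graphState G x) = graphState G x := by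
  rw [graphState_eq, star_mul', star_graphSign]
  simp

theorem inv_sqrt_two_mul_self : ((1 / √2 : ℝ) : ℂ) * ((1 / √2 : ℝ) : ℂ) = 1 / 2 := by
  rw [← Complex.ofReal_mul]
  have : (1 / √2 : ℝ) * (1 / √2) = 1 / 2 := by
    rw [div_mul_div_comm, Real.mul_self_sqrt (by norm_num)]; norm_num
  rw [this]; norm_num

theorem graphState_mul (x y : V → ZMod 2) :
    graphState G x * graphState G y = (1 / 2) ^ Fintype.card V * (graphSign G x * graphSign G y) := by
  rw [graphState_eq, graphState_eq, ← inv_sqrt_two_mul_self, mul_pow]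
  ring

theorem graphState_mul_self (x : V → ZMod 2) :
    graphState G x * graphState G x = (1 / 2) ^ Fintype.card V := by
  rw [graphState_mul, graphSign_mul_self, mul_one]

/-- The damping of the coherence between two values of a qubit that differ by `z`. -/
def damping (q : ℝ) (z : ZMod 2) : ℂ := if z = 0 then 1 else q

/-- The graph state whose qubit `v` has been dephased by the factor `q v`. -/
def dephased (q : V → ℝ) : Matrix (∀ v, Qubits V v) (∀ v, Qubits V v) ℂ :=
  Matrix.of fun x y => graphState G x * graphState G y * ∏ v, damping (q v) (x v + y v)

/-- This is the Fourier expansion on one bit: dephasing by `1 - 2p` is the mixture of "no flip" and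
"flip" with weights `1 - p` and `p`. -/
theorem damping_eq_sum (p : ℝ) (z : ZMod 2) :
    damping (1 - 2 * p) z = ∑ b : ZMod 2, ((if b = 1 then p else 1 - p : ℝ) : ℂ) * bitSign (b * z) := by
  rw [sum_zmod_two]
  rcases zmod_two_cases z with rfl | rfl <;> simp [damping, bitSign]
  ring

theorem prod_damping_eq_sum {ι : Type} [Fintype ι] [DecidableEq ι] (p : ℝ) (z : ι → ZMod 2) :
    ∏ v, damping (1 - 2 * p) (z v) =
      ∑ j : ι → ZMod 2, (errorProb p j : ℂ) * ∏ v, bitSign (j v * z v) := by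
  simp only [damping_eq_sum, Fintype.prod_sum, errorProb, Complex.ofReal_prod,
    Finset.prod_mul_distrib]

/-- The error `Z_j` multiplies the entry `(x, y)` by the character `j` at `x + y`, and averaging
over independent errors factors over the vertices. -/
theorem noisyGraphState_eq_dephased (p : ℝ) :
    noisyGraphState G p = dephased G fun _ => 1 - 2 * p := by
  ext x y
  simp only [noisyGraphState, Matrix.sum_apply, Matrix.smul_apply, Matrix.vecMulVec_apply,
    smul_eq_mul, dephased, Matrix.of_apply, prod_damping_eq_sum, Finset.mul_sum]
  refine Finset.sum_congr rfl fun j _ => ?_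
  simp only [Pi.star_apply, zRotate, star_mul', star_prod, star_bitSign, star_graphState, mul_add,
    bitSign_add, Finset.prod_mul_distrib]
  ring

theorem trace_dephased (q : V → ℝ) : (dephased G q).trace = 1 := by
  simp [Matrix.trace, dephased, graphState_mul_self, damping, CharTwo.add_self_eq_zero]

/-- The signs of the graph state cancel in pairs. Only the damping kernel remains, and for fixed `x`
its sum over `y` is `∏ (1 + q v)`. -/
theorem expectation_dephased (q : V → ℝ) :
    star (graphState G) ⬝ᵥ (dephased G q *ᵥ graphState G) = ∏ v, ((1 + q v) / 2 : ℂ) := by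
  have h : ∀ x y : V → ZMod 2,
      star (graphState G) x * (dephased G q x y * graphState G y) =
        (1 / 4) ^ Fintype.card V * ∏ v, damping (q v) (x v + y v) := by
    intro x y
    rw [Pi.star_apply, star_graphState, dephased, Matrix.of_apply]
    have : (1 / 4 : ℂ) ^ Fintype.card V = (graphState G x * graphState G x) *
        (graphState G y * graphState G y) := by
      rw [graphState_mul_self, graphState_mul_self, ← mul_pow]; norm_num
    rw [this]; ring
  simp only [dotProduct, Matrix.mulVec, Finset.mul_sum, h]
  have h2 : ∀ x : V → ZMod 2, ∑ y : V → ZMod 2, (1 / 4 : ℂ) ^ Fintype.card V *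
      ∏ v, damping (q v) (x v + y v) = (1 / 4) ^ Fintype.card V * ∏ v, (1 + q v : ℂ) := by
    intro x
    rw [← Finset.mul_sum, ← Fintype.prod_sum fun v b => damping (q v) (x v + b)]
    congr 1
    refine Finset.prod_congr rfl fun v _ => ?_
    rw [sum_zmod_two]
    have h11 : (1 : ZMod 2) + 1 = 0 := by decide
    rcases zmod_two_cases (x v) with h | h <;> simp [h, damping, h11, add_comm]
  simp only [h2, Finset.sum_const, Finset.card_univ, Fintype.card_pi, ZMod.card,
    Finset.prod_const, nsmul_eq_mul, Finset.prod_div_distrib]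
  rw [← mul_assoc, Nat.cast_pow, ← mul_pow,
    show ((2 : ℕ) : ℂ) * (1 / 4) = 2⁻¹ by norm_num, inv_pow, inv_mul_eq_div]

theorem trace_smul_dephased (c : ℝ) (q : V → ℝ) :
    ((c : ℂ) • dephased G q).trace.re = c := by
  rw [Matrix.trace_smul, trace_dephased]; simp

theorem fidelity_smul_dephased {c : ℝ} (hc : 0 < c) (q : V → ℝ) :
    fidelity (graphState G) ((c : ℂ) • dephased G q) = ∏ v, (1 + q v) / 2 := by
  unfold fidelity
  rw [trace_smul_dephased, Matrix.smul_mulVec, dotProduct_smul, expectation_dephased, smul_eq_mul,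
    Complex.re_ofReal_mul, mul_div_cancel_left₀ _ hc.ne']
  have : ∏ v, ((1 + q v) / 2 : ℂ) = ((∏ v, (1 + q v) / 2 : ℝ) : ℂ) := by push_cast; rfl
  rw [this, Complex.ofReal_re]

theorem initialFidelity_eq (p : ℝ) : initialFidelity G p = (1 - p) ^ Fintype.card V := by
  unfold initialFidelity
  have := fidelity_smul_dephased G one_pos fun _ : V => 1 - 2 * p
  rw [Complex.ofReal_one, one_smul, ← noisyGraphState_eq_dephased] at this
  rw [this, Finset.prod_const, Finset.card_univ]
  ring

end Dephased

/-! ### Partial transposition -/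

section PartialTranspose

variable {V : Type} (A : Set V)

open Classical in
/-- The configuration that agrees with `y` on `A` and with `x` elsewhere. -/
def swapOn {d : V → Type} (x y : ∀ v, d v) : ∀ v, d v := fun v => if v ∈ A then y v else x v

theorem swapOn_swapOn {d : V → Type} (x y : ∀ v, d v) :
    swapOn A (swapOn A x y) (swapOn A y x) = x := by
  funext v; unfold swapOn; split <;> simp_all

theorem swapOn_self {d : V → Type} (x : ∀ v, d v) : swapOn A x x = x := by
  funext v; simp [swapOn]

/-- The exchange of the `A`-parts of two configurations. -/
def swapEquiv (d : V → Type) : (∀ v, d v) × (∀ v, d v) ≃ (∀ v, d v) × (∀ v, d v) where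
  toFun z := (swapOn A z.1 z.2, swapOn A z.2 z.1)
  invFun z := (swapOn A z.1 z.2, swapOn A z.2 z.1)
  left_inv z := by simp [swapOn_swapOn]
  right_inv z := by simp [swapOn_swapOn]

/-- Exchanging the `A`-parts is an involution on pairs. This reindexing moves a partial
transposition from one factor of a trace to the other. -/
theorem sum_swapOn {d : V → Type} [Fintype (∀ v, d v)] {M : Type*} [AddCommMonoid M]
    (f : (∀ v, d v) → (∀ v, d v) → M) :
    ∑ x, ∑ y, f x y = ∑ x, ∑ y, f (swapOn A x y) (swapOn A y x) := by
  rw [← Fintype.sum_prod_type', ← Fintype.sum_prod_type',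
    ← Equiv.sum_comp (swapEquiv A d) fun z => f z.1 z.2]
  rfl

/-- The partial transpose with respect to the parties in `A`. -/
def partialTranspose {d : V → Type} (σ : Matrix (∀ v, d v) (∀ v, d v) ℂ) :
    Matrix (∀ v, d v) (∀ v, d v) ℂ :=
  Matrix.of fun x y => σ (swapOn A x y) (swapOn A y x)

open Classical in
/-- Complex conjugation of the local operators of the parties in `A`. -/
def conjOn {d m : V → Type} (K : ∀ v, Matrix (m v) (d v) ℂ) (v : V) : Matrix (m v) (d v) ℂ :=
  if v ∈ A then (K v).map star else K v

/-- For a party in `A`, exchanging row and column indices swaps its operator on the left with the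
conjugate operator on the right; parties outside `A` are unaffected. The result is again a
congruence, hence preserves positivity. -/
theorem partialTranspose_conj [Fintype V] {d m : V → Type} [Fintype (∀ v, d v)]
    (K : ∀ v, Matrix (m v) (d v) ℂ) (σ : Matrix (∀ v, d v) (∀ v, d v) ℂ) :
    partialTranspose A (tensorOp K * σ * (tensorOp K)ᴴ) =
      tensorOp (conjOn A K) * partialTranspose A σ * (tensorOp (conjOn A K))ᴴ := by
  ext x y
  rw [partialTranspose, Matrix.of_apply, conj_apply, conj_apply, sum_swapOn A]
  refine Finset.sum_congr rfl fun X _ => Finset.sum_congr rfl fun Y _ => ?_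
  have hmul : ∀ a b c a' c' : ℂ, a * c = a' * c' → a * b * c = a' * b * c' := by
    intro a b c a' c' h
    rw [mul_right_comm, h, mul_right_comm]
  refine hmul _ _ _ _ _ ?_
  simp only [tensorOp_apply, star_prod, ← Finset.prod_mul_distrib]
  refine Finset.prod_congr rfl fun v _ => ?_
  unfold swapOn conjOn
  split <;> simp [mul_comm]

theorem partialTranspose_sum {ι : Type*} (s : Finset ι) {d : V → Type}
    (σ : ι → Matrix (∀ v, d v) (∀ v, d v) ℂ) :
    partialTranspose A (∑ i ∈ s, σ i) = ∑ i ∈ s, partialTranspose A (σ i) := by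
  ext x y
  simp [partialTranspose, Matrix.sum_apply]

theorem partialTranspose_zero {d : V → Type} :
    partialTranspose A (0 : Matrix (∀ v, d v) (∀ v, d v) ℂ) = 0 := rfl

theorem trace_partialTranspose {d : V → Type} [Fintype (∀ v, d v)]
    (σ : Matrix (∀ v, d v) (∀ v, d v) ℂ) : (partialTranspose A σ).trace = σ.trace := by
  simp [Matrix.trace, partialTranspose, swapOn_self]

theorem SLOCC.apply_last [Fintype V] [DecidableEq V] {e : V → Type} [∀ v, Fintype (e v)]
    {d : V → Type} [∀ v, Fintype (d v)] (R : LocalRound d e) (accept : (∀ v, R.Outcome v) → Bool)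
    (ρ : Matrix (∀ v, d v) (∀ v, d v) ℂ) :
    (SLOCC.last R accept).apply ρ = ∑ o : ∀ v, R.Outcome v,
      if accept o then
        tensorOp (fun v => R.kraus v (o v)) * ρ * (tensorOp fun v => R.kraus v (o v))ᴴ
      else 0 := by
  simp only [SLOCC.apply]

theorem SLOCC.apply_step [Fintype V] [DecidableEq V] {e : V → Type} [∀ v, Fintype (e v)]
    {r : ℕ} {d : V → Type} [∀ v, Fintype (d v)] (m : V → Type) (finMid : ∀ v, Fintype (m v))
    (R : LocalRound d m) (next : (∀ v, R.Outcome v) → SLOCC e r m)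
    (ρ : Matrix (∀ v, d v) (∀ v, d v) ℂ) :
    (SLOCC.step m finMid R next).apply ρ = ∑ o : ∀ v, R.Outcome v,
      (next o).apply
        (tensorOp (fun v => R.kraus v (o v)) * ρ * (tensorOp fun v => R.kraus v (o v))ᴴ) := by
  simp only [SLOCC.apply]

/-- Protocols preserve positivity of the partial transpose. -/
theorem SLOCC.partialTranspose_posSemidef [Fintype V] [DecidableEq V] {e : V → Type}
    [∀ v, Fintype (e v)] {r : ℕ} {d : V → Type} (hd : ∀ v, Fintype (d v)) (P : SLOCC e r d)
    (ρ : Matrix (∀ v, d v) (∀ v, d v) ℂ) (hρ : (partialTranspose A ρ).PosSemidef) :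
    (partialTranspose A (P.apply ρ)).PosSemidef := by
  induction P with
  | last R accept =>
    rw [SLOCC.apply_last, partialTranspose_sum]
    refine Matrix.posSemidef_sum _ fun o _ => ?_
    split
    · rw [partialTranspose_conj]
      exact hρ.mul_mul_conjTranspose_same _
    · rw [partialTranspose_zero]; exact Matrix.PosSemidef.zero
  | step m finMid R next ih =>
    rw [SLOCC.apply_step, partialTranspose_sum]
    refine Matrix.posSemidef_sum _ fun o _ => ih o _ _ ?_
    rw [partialTranspose_conj]
    exact hρ.mul_mul_conjTranspose_same _

end PartialTranspose

/-! ### Positive semidefinite kernels -/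

theorem posSemidef_prod {ι X : Type*} [Finite X] (s : Finset ι) (K : ι → X → X → ℂ)
    (hK : ∀ i ∈ s, (Matrix.of (K i)).PosSemidef) :
    (Matrix.of fun x y => ∏ i ∈ s, K i x y).PosSemidef := by
  classical
  induction s using Finset.induction_on with
  | empty =>
    have h : (Matrix.of fun x y => ∏ i ∈ (∅ : Finset ι), K i x y) =
        Matrix.vecMulVec (fun _ : X => (1 : ℂ)) (star fun _ : X => (1 : ℂ)) := by
      ext x y; simp [Matrix.vecMulVec_apply]
    rw [h]
    exact Matrix.posSemidef_vecMulVec_self_star _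
  | insert i s hi ih =>
    have h : (Matrix.of fun x y => ∏ i ∈ insert i s, K i x y) =
        Matrix.of (K i) ⊙ Matrix.of fun x y => ∏ i ∈ s, K i x y := by
      ext x y; simp [Finset.prod_insert hi]
    rw [h]
    exact (hK i (Finset.mem_insert_self i s)).hadamard
      (ih fun j hj => hK j (Finset.mem_insert_of_mem hj))

theorem posSemidef_mul_diag {X : Type*} [Finite X] (f : X → ℂ) (K : X → X → ℂ)
    (hK : (Matrix.of K).PosSemidef) :
    (Matrix.of fun x y => f x * star (f y) * K x y).PosSemidef :=
  (Matrix.posSemidef_vecMulVec_self_star f).hadamard hK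

theorem posSemidef_of_eq_sum {ι X : Type*} [Fintype ι] [Finite X] (c : ι → ℝ) (f : ι → X → ℂ)
    (hc : ∀ i, 0 ≤ c i) (K : X → X → ℂ)
    (hK : ∀ x y, K x y = ∑ i, (c i : ℂ) * (f i x * star (f i y))) : (Matrix.of K).PosSemidef := by
  have h : Matrix.of K = ∑ i, (c i : ℂ) • Matrix.vecMulVec (f i) (star (f i)) := by
    ext x y
    simp [hK, Matrix.sum_apply, Matrix.vecMulVec_apply]
  rw [h]
  refine Matrix.posSemidef_sum _ fun i _ => ?_
  exact (Matrix.posSemidef_vecMulVec_self_star _).smul (by exact_mod_cast hc i)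

/-- The partial transpose of the copies is an entrywise product of pull-backs of that of one copy,
so the Schur product theorem applies. -/
theorem posSemidef_copies {V C : Type} [Fintype V] [Fintype C] (A : Set V)
    (ρ : Matrix (∀ v, Qubits V v) (∀ v, Qubits V v) ℂ) (hρ : (partialTranspose A ρ).PosSemidef) :
    (partialTranspose A (copies C ρ)).PosSemidef := by
  have := posSemidef_prod Finset.univ
    (fun (c : C) (x y : ∀ v, Copies V C v) => partialTranspose A ρ (fun v => x v c) (fun v => y v c))
    fun c _ => hρ.submatrix fun (x : ∀ v, Copies V C v) v => x v c
  convert this using 1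
  ext x y
  simp only [partialTranspose, copies, Matrix.of_apply]
  refine Finset.prod_congr rfl fun c _ => ?_
  congr 1 <;> funext v <;> unfold swapOn <;> split <;> rfl

/-! ### Fourier analysis on bit strings -/

section Fourier

variable {V : Type} [Fintype V]

/-- The characters of the group of bit strings. -/
def bitChar (k z : V → ZMod 2) : ℂ := ∏ v, bitSign (k v * z v)

theorem bitChar_add (k x y : V → ZMod 2) : bitChar k (x + y) = bitChar k x * bitChar k y := by
  simp [bitChar, mul_add, bitSign_add, Finset.prod_mul_distrib]

theorem star_bitChar (k x : V → ZMod 2) : star (bitChar k x) = bitChar k x := by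
  simp only [bitChar, star_prod, star_bitSign]

theorem sum_bitChar [DecidableEq V] (z : V → ZMod 2) :
    ∑ k, bitChar k z = if z = 0 then (2 : ℂ) ^ Fintype.card V else 0 := by
  unfold bitChar
  rw [← Fintype.prod_sum fun v b => bitSign (b * z v)]
  have h : ∀ v, ∑ b : ZMod 2, bitSign (b * z v) = if z v = 0 then (2 : ℂ) else 0 := by
    intro v
    rw [sum_zmod_two]
    rcases zmod_two_cases (z v) with h | h <;> simp [h, bitSign]
    norm_num
  simp only [h, Finset.prod_ite_zero]
  simp [funext_iff]

theorem fourier_inversion [DecidableEq V] (φ : (V → ZMod 2) → ℂ) (z : V → ZMod 2) :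
    φ z = ∑ k, (1 / 2) ^ Fintype.card V * (∑ w, φ w * bitChar k w) * bitChar k z := by
  have h : ∀ w, ∑ k : V → ZMod 2, bitChar k w * bitChar k z =
      if w = z then (2 : ℂ) ^ Fintype.card V else 0 := by
    intro w
    simp only [← bitChar_add, sum_bitChar]
    have : w + z = 0 ↔ w = z := by
      simp only [funext_iff, Pi.add_apply, Pi.zero_apply, zmod_two_add_eq_zero_iff]
    simp only [this]
  simp only [Finset.mul_sum, Finset.sum_mul]
  rw [Finset.sum_comm]
  have h2 : ∀ w, ∑ k : V → ZMod 2, (1 / 2 : ℂ) ^ Fintype.card V * (φ w * bitChar k w) * bitChar k z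
      = if w = z then φ w else 0 := by
    intro w
    have : ∀ k : V → ZMod 2, (1 / 2 : ℂ) ^ Fintype.card V * (φ w * bitChar k w) * bitChar k z =
      (1 / 2 : ℂ) ^ Fintype.card V * φ w * (bitChar k w * bitChar k z) := fun k => by ring
    simp only [this, ← Finset.mul_sum, h]
    split
    · rw [mul_right_comm, ← mul_pow]; norm_num
    · simp
  simp only [h2, Finset.sum_ite_eq', Finset.mem_univ, if_true]

/-- A translation-invariant kernel with non-negative Fourier coefficients is positive
semidefinite. -/
theorem posSemidef_of_fourier_nonneg [DecidableEq V] (φ : (V → ZMod 2) → ℂ)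
    (h : ∀ k, 0 ≤ ∑ w, φ w * bitChar k w) :
    (Matrix.of fun x y => φ (x + y)).PosSemidef := by
  have key : (Matrix.of fun x y => φ (x + y)) = ∑ k : V → ZMod 2,
      ((1 / 2) ^ Fintype.card V * ∑ w, φ w * bitChar k w) •
        Matrix.vecMulVec (bitChar k) (star (bitChar k)) := by
    ext x y
    rw [Matrix.of_apply, fourier_inversion φ, Matrix.sum_apply]
    refine Finset.sum_congr rfl fun k _ => ?_
    rw [Matrix.smul_apply, Matrix.vecMulVec_apply, Pi.star_apply, star_bitChar, bitChar_add,
      smul_eq_mul]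
  rw [key]
  refine Matrix.posSemidef_sum _ fun k _ => ?_
  refine (Matrix.posSemidef_vecMulVec_self_star _).smul (mul_nonneg (pow_nonneg ?_ _) (h k))
  rw [show (1 / 2 : ℂ) = ((1 / 2 : ℝ) : ℂ) by norm_num]
  exact_mod_cast (by norm_num : (0 : ℝ) ≤ 1 / 2)

end Fourier

/-! ### Edges across a partition -/

section Crossing

variable {V : Type} [Fintype V] [DecidableEq V] (G : SimpleGraph V) [DecidableRel G.Adj] (A : Set V)

/-- The edge has one end in `A` and one outside `A`. -/
def Crosses (e : Sym2 V) : Prop := ∃ a ∈ e, ∃ b ∈ e, a ∈ A ∧ b ∉ A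

theorem crosses_mk {V : Type} (A : Set V) (a b : V) : Crosses A s(a, b) ↔ ¬ (a ∈ A ↔ b ∈ A) := by
  simp only [Crosses, Sym2.mem_iff, exists_eq_or_imp, exists_eq_left]
  tauto

open Classical in
/-- The edges across the partition. -/
def crossEdges : Finset (Sym2 V) := G.edgeFinset.filter (Crosses A)

theorem mk_mem_crossEdges {V : Type} [Fintype V] (G : SimpleGraph V) [DecidableRel G.Adj]
    (A : Set V) (a b : V) :
    s(a, b) ∈ crossEdges G A ↔ G.Adj a b ∧ ¬ (a ∈ A ↔ b ∈ A) := by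
  simp [crossEdges, crosses_mk]

/-- The product of the signs of the controlled-phase gates across the partition. -/
def crossSign (z : V → ZMod 2) : ℂ := ∏ e ∈ crossEdges G A, edgeSign e z

theorem crossSign_mul_self (x : V → ZMod 2) : crossSign G A x * crossSign G A x = 1 := by
  simp [crossSign, ← Finset.prod_mul_distrib, edgeSign_mul_self]

/-- An edge inside one part contributes the same sign before and after the exchange. For a crossing
edge the exponents differ by the cross term `(x a + y a) * (x b + y b)`, by the polarisation
identity `key`. -/
theorem graphSign_swapOn (x y : V → ZMod 2) :
    graphSign G (swapOn A x y) * graphSign G (swapOn A y x) =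
      graphSign G x * graphSign G y * crossSign G A (x + y) := by
  classical
  simp only [graphSign, crossSign, crossEdges]
  rw [Finset.prod_filter]
  simp only [← Finset.prod_mul_distrib]
  refine Finset.prod_congr rfl fun e _ => ?_
  induction e using Sym2.ind with
  | _ a b =>
    simp only [edgeSign_mk, crosses_mk, swapOn, Pi.add_apply]
    have key : ∀ p q r s : ZMod 2, p * s + r * q = p * q + r * s + (p + r) * (q + s) := by
      decide
    by_cases ha : a ∈ A <;> by_cases hb : b ∈ A <;> simp [ha, hb, ← bitSign_add]
    · rw [add_comm]
    · rw [← key, add_comm]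
    · rw [← key]

/-- The exchange leaves every `x v + y v` unchanged, so the damping is untouched and only the
crossing signs appear. What remains besides a diagonal congruence is a function of `x + y`. -/
theorem partialTranspose_dephased (q : V → ℝ) (x y : V → ZMod 2) :
    partialTranspose A (dephased G q) x y = graphState G x * graphState G y *
      (crossSign G A (x + y) * ∏ v, damping (q v) ((x + y) v)) := by
  have h : ∀ v, swapOn A x y v + swapOn A y x v = x v + y v := by
    intro v; unfold swapOn; split
    · exact add_comm _ _
    · rfl
  simp only [partialTranspose, dephased, Matrix.of_apply, graphState_mul, graphSign_swapOn, h,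
    Pi.add_apply]
  ring

variable {G A}

/-- This is where the threshold enters: the coefficient at the character `(1, 1)` is `(1 - 2q - q²)
/ 4`, which is non-negative exactly when `(1 + q)² ≤ 2`. -/
theorem posSemidef_crossing_edge {q : ℝ} (h0 : 0 ≤ q) (hq : (1 + q) ^ 2 ≤ 2) (a b : V) :
    (Matrix.of fun x y : V → ZMod 2 => edgeSign s(a, b) (x + y) *
      (damping q ((x + y) a) * damping q ((x + y) b))).PosSemidef := by
  -- `r k` is `q` with the sign of `k`; the weights below are the Fourier coefficients of `(1, q, q,
  -- -q²)`.
  let r : ZMod 2 → ℝ := fun b => if b = 0 then q else -q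
  refine posSemidef_of_eq_sum
    (fun k : ZMod 2 × ZMod 2 => (1 + r k.1 + r k.2 - r k.1 * r k.2) / 4)
    (fun k x => bitSign (k.1 * x a + k.2 * x b)) ?_ _ ?_
  · rintro ⟨k, l⟩
    rcases zmod_two_cases k with rfl | rfl <;> rcases zmod_two_cases l with rfl | rfl <;>
      simp [r] <;> nlinarith
  · intro x y
    simp only [star_bitSign, ← bitSign_add, edgeSign_mk, Pi.add_apply]
    have : ∀ k : ZMod 2 × ZMod 2, k.1 * x a + k.2 * x b + (k.1 * y a + k.2 * y b) =
      k.1 * (x a + y a) + k.2 * (x b + y b) := fun k => by ring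
    simp only [this, Fintype.sum_prod_type, sum_zmod_two]
    rcases zmod_two_cases (x a + y a) with h | h <;> rcases zmod_two_cases (x b + y b) with h' | h' <;>
      simp [h, h', r, damping, bitSign, show (1 : ZMod 2) + 1 = 0 by decide] <;> ring

theorem posSemidef_damping {V : Type} [Fintype V] {q : ℝ} (h0 : 0 ≤ q) (hq : q ≤ 1) (v : V) :
    (Matrix.of fun x y : V → ZMod 2 => damping q ((x + y) v)).PosSemidef := by
  refine posSemidef_of_eq_sum
    (fun k : ZMod 2 => if k = 1 then (1 - q) / 2 else 1 - (1 - q) / 2)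
    (fun k x => bitSign (k * x v)) ?_ _ ?_
  · intro k
    split_ifs <;> linarith
  · intro x y
    have h := damping_eq_sum ((1 - q) / 2) ((x + y) v)
    rw [show 1 - 2 * ((1 - q) / 2) = q by ring] at h
    rw [h]
    simp only [star_bitSign, ← bitSign_add, Pi.add_apply, mul_add]

/-- Below the threshold the noisy state has a positive partial transpose. -/
theorem posSemidef_partialTranspose_noisy
    (hA : ∀ v, {w | G.Adj v w ∧ ¬ (v ∈ A ↔ w ∈ A)}.Subsingleton) {q : ℝ} (h0 : 0 ≤ q)
    (hq : (1 + q) ^ 2 ≤ 2) :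
    (partialTranspose A (dephased G fun _ => q)).PosSemidef := by
  have hq1 : q ≤ 1 := by nlinarith
  have hprod : ∀ z : V → ZMod 2, crossSign G A z * ∏ v, damping q (z v) =
      (∏ e ∈ crossEdges G A, edgeSign e z * ∏ v ∈ e.toFinset, damping q (z v)) *
        ∏ v ∈ ((crossEdges G A).biUnion Sym2.toFinset)ᶜ, damping q (z v) := by
    intro z
    -- A vertex lies on at most one crossing edge, so distinct crossing edges are disjoint and each
    -- damping factor goes to exactly one factor of the product.
    have hd : ((crossEdges G A : Finset (Sym2 V)) : Set (Sym2 V)).PairwiseDisjoint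
        Sym2.toFinset := by
      intro e he f hf hef
      rw [Function.onFun, Finset.disjoint_left]
      intro v hve hvf
      rw [Sym2.mem_toFinset] at hve hvf
      obtain ⟨w, rfl⟩ := hve
      obtain ⟨w', rfl⟩ := hvf
      rw [Finset.mem_coe, mk_mem_crossEdges] at he hf
      exact hef (by rw [hA v he hf])
    rw [Finset.prod_mul_distrib, ← Finset.prod_biUnion hd, mul_assoc, Finset.prod_mul_prod_compl,
      crossSign]
  have hK : (Matrix.of fun x y : V → ZMod 2 =>
      crossSign G A (x + y) * ∏ v, damping q ((x + y) v)).PosSemidef := by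
    simp only [hprod]
    refine Matrix.PosSemidef.hadamard (A := Matrix.of fun x y : V → ZMod 2 => ∏ e ∈ crossEdges G A,
      edgeSign e (x + y) * ∏ v ∈ e.toFinset, damping q ((x + y) v))
      (B := Matrix.of fun x y : V → ZMod 2 => ∏ v ∈ ((crossEdges G A).biUnion Sym2.toFinset)ᶜ,
        damping q ((x + y) v)) ?_ ?_
    · refine posSemidef_prod _ (fun e (x y : V → ZMod 2) =>
        edgeSign e (x + y) * ∏ v ∈ e.toFinset, damping q ((x + y) v)) fun e he => ?_
      induction e using Sym2.ind with
      | _ a b =>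
        rw [mk_mem_crossEdges] at he
        have hab : a ≠ b := he.1.ne
        simp only [Sym2.toFinset_mk_eq, Finset.prod_pair hab]
        exact posSemidef_crossing_edge h0 hq a b
    · exact posSemidef_prod _ (fun v (x y : V → ZMod 2) => damping q ((x + y) v))
        fun v _ => posSemidef_damping h0 hq1 v
  have := posSemidef_mul_diag (graphState G) _ hK
  have he : partialTranspose A (dephased G fun _ => q) = Matrix.of fun x y : V → ZMod 2 =>
      graphState G x * star (graphState G y) *
        (crossSign G A (x + y) * ∏ v, damping q ((x + y) v)) := by
    ext x y
    rw [partialTranspose_dephased, Matrix.of_apply, star_graphState]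
  rw [he]
  exact this

/-- Flipping the bit at `a` affects only crossing edges at `a`, and `ab` is the only one. -/
theorem crossSign_add_single (hA : ∀ v, {w | G.Adj v w ∧ ¬ (v ∈ A ↔ w ∈ A)}.Subsingleton) {a b : V}
    (hab : G.Adj a b) (hc : ¬ (a ∈ A ↔ b ∈ A)) (z : V → ZMod 2) :
    crossSign G A (z + Pi.single a 1) = crossSign G A z * bitSign (z b) := by
  have hmem : s(a, b) ∈ crossEdges G A := (mk_mem_crossEdges G A a b).2 ⟨hab, hc⟩
  unfold crossSign
  rw [← Finset.mul_prod_erase _ _ hmem, ← Finset.mul_prod_erase _ _ hmem, mul_right_comm]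
  congr 1
  · simp [edgeSign_mk, hab.ne', add_mul, bitSign_add]
  · refine Finset.prod_congr rfl fun e he => ?_
    rw [Finset.mem_erase] at he
    have ha : a ∉ e := by
      rintro ⟨w, rfl⟩
      have := (mk_mem_crossEdges G A a w).1 he.2
      exact he.1 (by rw [hA a this ⟨hab, hc⟩])
    induction e using Sym2.ind with
    | _ c d =>
      rw [Sym2.mem_iff, not_or] at ha
      simp [edgeSign_mk, Ne.symm ha.1, Ne.symm ha.2]

theorem bitChar_mul_self {V : Type} [Fintype V] (k x : V → ZMod 2) :
    bitChar k x * bitChar k x = 1 := by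
  simp [bitChar, ← Finset.prod_mul_distrib, bitSign_mul_self]

/-- The bound is half the trivial one, and a single crossing edge suffices: averaging over the flips
of `a` and `b` groups the signs into fours, each with sum at most `2`. This makes the partial
transpose of the pure graph state at most `1/2`. -/
theorem sum_crossSign_le (hA : ∀ v, {w | G.Adj v w ∧ ¬ (v ∈ A ↔ w ∈ A)}.Subsingleton) {a b : V}
    (hab : G.Adj a b) (hc : ¬ (a ∈ A ↔ b ∈ A)) (k : V → ZMod 2) :
    ∑ z, crossSign G A z * bitChar k z ≤ 2 ^ Fintype.card V / 2 := by
  set F : (V → ZMod 2) → ℂ := fun z => crossSign G A z * bitChar k z with hF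
  set α := bitChar k (Pi.single a 1) with hα
  set β := bitChar k (Pi.single b 1) with hβ
  have hFa : ∀ z, F (z + Pi.single a 1) = F z * (bitSign (z b) * α) := by
    intro z
    simp only [hF, crossSign_add_single hA hab hc, bitChar_add]; ring
  have hFb : ∀ z, F (z + Pi.single b 1) = F z * (bitSign (z a) * β) := by
    intro z
    simp only [hF, crossSign_add_single hA hab.symm (fun h => hc h.symm), bitChar_add]; ring
  have hsq : ∀ c : ℂ, c * c = 1 → c = 1 ∨ c = -1 := fun c h => mul_self_eq_one_iff.1 h
  -- The four signs multiply to `-1`, because flipping `a` reverses the effect of flipping `b`;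
  -- hence at least one of them is `-1`.
  have hle : ∀ z, F z + F (z + Pi.single a 1) + F (z + Pi.single b 1) +
      F (z + Pi.single a 1 + Pi.single b 1) ≤ 2 := by
    intro z
    rw [hFb (z + Pi.single a 1), hFa, hFb]
    have h1 : (z + Pi.single a 1 : V → ZMod 2) a = z a + 1 := by simp
    rw [h1, bitSign_add, bitSign_one]
    have hF2 := hsq (F z) (by
      simp only [hF]
      rw [mul_mul_mul_comm, crossSign_mul_self, bitChar_mul_self, mul_one])
    have hα2 := hsq (bitSign (z b) * α) (by
      rw [mul_mul_mul_comm, bitSign_mul_self, bitChar_mul_self, mul_one])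
    have hβ2 := hsq (bitSign (z a) * β) (by
      rw [mul_mul_mul_comm, bitSign_mul_self, bitChar_mul_self, mul_one])
    have hr : bitSign (z a) * -1 * β = -(bitSign (z a) * β) := by ring
    rw [hr]
    rcases hF2 with h | h <;> rcases hα2 with h' | h' <;> rcases hβ2 with h'' | h'' <;>
      rw [h, h', h''] <;> norm_num
  have hsum := Finset.sum_le_sum (s := (Finset.univ : Finset (V → ZMod 2))) fun z _ => hle z
  simp only [Finset.sum_add_distrib] at hsum
  have hshift : ∀ w : V → ZMod 2, ∑ z, F (z + w) = ∑ z, F z := fun w =>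
    Equiv.sum_comp (Equiv.addRight w) F
  have hshift2 : ∑ z : V → ZMod 2, F (z + Pi.single a 1 + Pi.single b 1) = ∑ z, F z := by
    rw [← hshift (Pi.single a 1 + Pi.single b 1)]
    simp only [add_assoc]
  rw [hshift, hshift, hshift2] at hsum
  simp only [Finset.sum_const, Finset.card_univ, Fintype.card_pi, ZMod.card, Finset.prod_const,
    nsmul_eq_mul] at hsum
  have h4 : ∑ z, F z = (1 / 4 : ℝ) • (∑ z, F z + ∑ z, F z + ∑ z, F z + ∑ z, F z) := by
    rw [Complex.real_smul]; push_cast; ring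
  have h5 : (2 : ℂ) ^ Fintype.card V / 2 = (1 / 4 : ℝ) • (((2 ^ Fintype.card V : ℕ) : ℂ) * 2) := by
    rw [Complex.real_smul]; push_cast; ring
  rw [h4, h5]
  exact smul_le_smul_of_nonneg_left hsum (by norm_num)

/-- A state with a positive partial transpose has fidelity at most one half with the graph state. -/
theorem expectation_le_of_partialTranspose_posSemidef
    (hA : ∀ v, {w | G.Adj v w ∧ ¬ (v ∈ A ↔ w ∈ A)}.Subsingleton) {a b : V}
    (hab : G.Adj a b) (hc : ¬ (a ∈ A ↔ b ∈ A))
    (σ : Matrix (∀ v, Qubits V v) (∀ v, Qubits V v) ℂ) (hσ : (partialTranspose A σ).PosSemidef) :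
    (star (graphState G) ⬝ᵥ (σ *ᵥ graphState G)).re ≤ σ.trace.re / 2 := by
  -- After conjugation by the diagonal signs, `φ (x + y)` is the kernel of `1/2` minus the partial
  -- transpose of the pure graph state.
  set φ : (V → ZMod 2) → ℂ := fun z =>
    (if z = 0 then 1 / 2 else 0) - (1 / 2) ^ Fintype.card V * crossSign G A z with hφ
  have hφ0 : ∀ k, 0 ≤ ∑ w, φ w * bitChar k w := by
    intro k
    have h1 : ∑ w, φ w * bitChar k w =
        1 / 2 - (1 / 2) ^ Fintype.card V * ∑ z, crossSign G A z * bitChar k z := by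
      simp only [hφ, sub_mul, Finset.sum_sub_distrib, Finset.mul_sum, mul_assoc, ite_mul, zero_mul]
      simp [bitChar, bitSign_zero]
    rw [h1, sub_nonneg]
    have h2 : (1 / 2 : ℂ) = (1 / 2 : ℂ) ^ Fintype.card V * (2 ^ Fintype.card V / 2) := by
      rw [← mul_div_assoc, ← mul_pow]; norm_num
    have h3 : (0 : ℂ) ≤ (1 / 2 : ℂ) ^ Fintype.card V := by
      rw [show (1 / 2 : ℂ) = ((1 / 2 : ℝ) : ℂ) by norm_num]
      exact pow_nonneg (by exact_mod_cast (by norm_num : (0 : ℝ) ≤ 1 / 2)) _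
    calc _ ≤ (1 / 2 : ℂ) ^ Fintype.card V * (2 ^ Fintype.card V / 2) :=
          mul_le_mul_of_nonneg_left (sum_crossSign_le hA hab hc k) h3
      _ = _ := h2.symm
  -- The entry sum of the Hadamard product with the partial transpose of `σ` is half the trace of
  -- `σ` minus the expectation, and positivity at the all-ones vector makes it non-negative.
  have hM := (posSemidef_mul_diag (graphSign G) _ (posSemidef_of_fourier_nonneg φ hφ0)).hadamard hσ
  have hnn := hM.dotProduct_mulVec_nonneg (fun _ => 1)
  have hval : star (fun _ : V → ZMod 2 => (1 : ℂ)) ⬝ᵥ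
      (((Matrix.of fun x y => graphSign G x * star (graphSign G y) * φ (x + y)) ⊙
        partialTranspose A σ) *ᵥ fun _ => 1) =
      σ.trace / 2 - star (graphState G) ⬝ᵥ (σ *ᵥ graphState G) := by
    have hL : star (graphState G) ⬝ᵥ (σ *ᵥ graphState G) =
        ∑ x, ∑ y, (1 / 2) ^ Fintype.card V * (graphSign G x * graphSign G y *
          crossSign G A (x + y)) * partialTranspose A σ x y := by
      simp only [dotProduct, Matrix.mulVec, Finset.mul_sum, Pi.star_apply, star_graphState]
      rw [sum_swapOn A]
      refine Finset.sum_congr rfl fun x _ => Finset.sum_congr rfl fun y _ => ?_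
      rw [← graphSign_swapOn, partialTranspose, Matrix.of_apply, ← graphState_mul]
      ring
    have hT : σ.trace / 2 = ∑ x : V → ZMod 2, ∑ y : V → ZMod 2,
        if x = y then graphSign G x * graphSign G y * (1 / 2) * partialTranspose A σ x y else 0 := by
      simp only [Finset.sum_ite_eq, Finset.mem_univ, if_true, graphSign_mul_self]
      rw [← trace_partialTranspose A, Matrix.trace, Finset.sum_div]
      refine Finset.sum_congr rfl fun x _ => ?_
      rw [Matrix.diag_apply]; ring
    rw [hL, hT, ← Finset.sum_sub_distrib]
    simp only [dotProduct, Matrix.mulVec, Pi.star_apply, star_one, one_mul, mul_one]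
    refine Finset.sum_congr rfl fun x _ => ?_
    rw [← Finset.sum_sub_distrib]
    refine Finset.sum_congr rfl fun y _ => ?_
    have hxy : x + y = 0 ↔ x = y := by
      simp only [funext_iff, Pi.add_apply, Pi.zero_apply, zmod_two_add_eq_zero_iff]
    simp only [Matrix.hadamard_apply, Matrix.of_apply, star_graphSign, hφ, hxy]
    split <;> ring
  rw [hval] at hnn
  have := (Complex.le_def.1 hnn).1
  simp at this
  linarith

/-- Connectedness provides a crossing edge on a walk between the two parts, which caps the fidelity
at `1/2`. -/
theorem not_purifiable (hG : IsLocallyReconstructible G) {p : ℝ} (hp : p ≤ 1 / 2)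
    (h : (1 - p) ^ 2 < 1 / 2) : ¬ Purifiable G p := by
  obtain ⟨hconn, A, ⟨a₀, ha₀⟩, ⟨b₀, hb₀⟩, hA⟩ := hG
  obtain ⟨w⟩ := hconn.preconnected a₀ b₀
  obtain ⟨d, -, hd1, hd2⟩ := w.exists_boundary_dart A ha₀ hb₀
  intro hpur
  -- Any target fidelity above `1/2` gives the contradiction; here it is `3/4`.
  obtain ⟨C, _, _, r, P, hpos, hfid⟩ := hpur (1 / 4) (by norm_num)
  have hppt : (partialTranspose A (P.apply (copies C (noisyGraphState G p)))).PosSemidef := by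
    refine SLOCC.partialTranspose_posSemidef A _ P _ (posSemidef_copies A _ ?_)
    rw [noisyGraphState_eq_dephased]
    exact posSemidef_partialTranspose_noisy hA (by linarith) (by nlinarith)
  have hle := expectation_le_of_partialTranspose_posSemidef hA d.adj (fun h => hd2 (h.1 hd1)) _ hppt
  rw [fidelity, le_div_iff₀ hpos] at hfid
  linarith

end Crossing

/-! ### Measurements with a prescribed outcome -/

open scoped MatrixOrder Matrix.Norms.L2Operator in
/-- Every operator is, up to a positive factor, a Kraus operator of some measurement. -/
theorem exists_measurement {d e : Type} [Fintype d] [DecidableEq d] [Fintype e] [Nonempty e]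
    (K : Matrix e d ℂ) : ∃ c : ℝ, 0 < c ∧ ∃ L : d → Matrix e d ℂ,
      ((c : ℂ) • K)ᴴ * ((c : ℂ) • K) + ∑ o, (L o)ᴴ * L o = 1 := by
  classical
  have hM := Matrix.posSemidef_conjTranspose_mul_self K
  set M := Kᴴ * K with hMdef
  -- A positive operator is bounded by its norm, so `1 - tM` is positive for `t = 1 / (‖M‖ + 1)`;
  -- adding one avoids division by zero when `K = 0`.
  have hle : M ≤ algebraMap ℝ (Matrix d d ℂ) ‖M‖ :=
    IsSelfAdjoint.le_algebraMap_norm_self hM.isHermitian.isSelfAdjoint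
  have hle' : (algebraMap ℝ (Matrix d d ℂ) ‖M‖ - M).PosSemidef := Matrix.le_iff.1 hle
  set t : ℝ := 1 / (‖M‖ + 1) with ht
  have hn : 0 ≤ ‖M‖ := norm_nonneg M
  have ht0 : 0 < t := by positivity
  have hpos : (1 - (t : ℂ) • M).PosSemidef := by
    have h1 : (1 : Matrix d d ℂ) - (t : ℂ) • M =
        (t : ℂ) • (algebraMap ℝ (Matrix d d ℂ) ‖M‖ - M) + (t : ℂ) • 1 := by
      have h2 : (1 : Matrix d d ℂ) = (t : ℂ) • algebraMap ℝ (Matrix d d ℂ) ‖M‖ + (t : ℂ) • 1 := by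
        rw [← smul_add]
        ext i j
        by_cases hij : i = j
        · subst hij
          have : t * (‖M‖ + 1) = 1 := by rw [ht]; field_simp
          simp [Matrix.algebraMap_matrix_apply]
          exact_mod_cast this.symm
        · simp [Matrix.algebraMap_matrix_apply, hij]
      nth_rewrite 1 [h2]
      rw [smul_sub]
      abel
    rw [h1]
    have h0 : (0 : ℂ) ≤ (t : ℂ) := by exact_mod_cast ht0.le
    exact (hle'.smul h0).add (Matrix.PosSemidef.one.smul h0)
  obtain ⟨B, hB⟩ := CStarAlgebra.nonneg_iff_eq_star_mul_self.1 hpos.nonneg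
  rw [Matrix.star_eq_conjTranspose] at hB
  obtain ⟨y₀⟩ := ‹Nonempty e›
  -- The remainder is `Bᴴ * B`, but the output space may be smaller than the input. It is therefore
  -- realised row by row: outcome `o` applies row `o` of `B` and outputs the fixed state `y₀`.
  refine ⟨√t, Real.sqrt_pos.2 ht0,
    fun o => Matrix.of fun y x => if y = y₀ then B o x else 0, ?_⟩
  have h1 : (((√t : ℝ) : ℂ) • K)ᴴ * (((√t : ℝ) : ℂ) • K) = (t : ℂ) • M := by
    rw [Matrix.conjTranspose_smul, Matrix.smul_mul, Matrix.mul_smul, smul_smul]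
    congr 1
    rw [Complex.star_def, Complex.conj_ofReal, ← Complex.ofReal_mul, Real.mul_self_sqrt ht0.le]
  have h2 : ∑ o, (Matrix.of fun (y : e) x => if y = y₀ then B o x else 0)ᴴ *
      (Matrix.of fun (y : e) x => if y = y₀ then B o x else 0) = Bᴴ * B := by
    ext x x'
    rw [Matrix.sum_apply]
    simp [Matrix.mul_apply]
  rw [h1, h2, ← hB]
  abel

/-- The outcome `none` carries the wanted operator. The others only complete the measurement and can
be rejected afterwards, so the factor `c` affects the success probability but not the fidelity. -/
theorem exists_localRound {V : Type} {d e : V → Type} [∀ v, Fintype (d v)] [∀ v, Fintype (e v)]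
    [∀ v, Nonempty (e v)] (K : ∀ v, Matrix (e v) (d v) ℂ) :
    ∃ (R : LocalRound d e) (o : ∀ v, R.Outcome v) (c : V → ℝ), (∀ v, 0 < c v) ∧
      ∀ v, R.kraus v (o v) = (c v : ℂ) • K v := by
  classical
  choose c hc L hL using fun v => exists_measurement (K v)
  refine ⟨{ Outcome := fun v => Option (d v)
            finOutcome := fun v => inferInstance
            kraus := fun v o => o.elim ((c v : ℂ) • K v) (L v)
            complete := ?_ }, fun _ => none, c, hc, fun v => rfl⟩
  intro v inst
  rw [Fintype.sum_option]
  convert hL v <;> rfl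

/-! ### Operators that undo the controlled-phase gates on their support -/

/-- If, on the support of the local operators, the entangling phase of the input depends only on the
output, it can be pulled out as `s`. The rest then factors into one-party sums. -/
theorem conj_tensorOp_of_support {V : Type} [Fintype V] [DecidableEq V] {d m : V → Type}
    [∀ v, Fintype (d v)] (K K' : ∀ v, Matrix (m v) (d v) ℂ) (Ψ : (∀ v, d v) → ℂ)
    (s : (∀ v, m v) → ℂ) (D : ∀ v, d v → d v → ℂ)
    (h : ∀ x X, (∏ v, K v (x v) (X v)) * Ψ X = s x * ∏ v, K' v (x v) (X v))
    (x y : ∀ v, m v) :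
    (tensorOp K * (Matrix.of fun X Y => Ψ X * star (Ψ Y) * ∏ v, D v (X v) (Y v)) * (tensorOp K)ᴴ) x y
      = s x * star (s y) *
        ∏ v, ∑ X, ∑ Y, K' v (x v) X * D v X Y * star (K' v (y v) Y) := by
  rw [conj_apply]
  have h1 : ∀ X Y, tensorOp K x X *
      (Matrix.of fun X Y => Ψ X * star (Ψ Y) * ∏ v, D v (X v) (Y v)) X Y * star (tensorOp K y Y) =
      s x * star (s y) * ∏ v, K' v (x v) (X v) * D v (X v) (Y v) * star (K' v (y v) (Y v)) := by
    intro X Y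
    rw [Matrix.of_apply, tensorOp_apply, tensorOp_apply]
    have h2 := congrArg star (h y Y)
    rw [star_mul', star_mul'] at h2
    calc _ = ((∏ v, K v (x v) (X v)) * Ψ X) * (star (∏ v, K v (y v) (Y v)) * star (Ψ Y)) *
          ∏ v, D v (X v) (Y v) := by ring
      _ = _ := by
        rw [h x X, h2, star_prod, Finset.prod_mul_distrib, Finset.prod_mul_distrib]
        ring
  simp only [h1, ← Finset.mul_sum]
  congr 1
  have h2 : ∀ X : ∀ v, d v, ∑ Y : ∀ v, d v,
      ∏ v, K' v (x v) (X v) * D v (X v) (Y v) * star (K' v (y v) (Y v)) =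
      ∏ v, ∑ Y, K' v (x v) (X v) * D v (X v) Y * star (K' v (y v) Y) := fun X => by
    rw [Fintype.prod_sum]
  simp only [h2]
  rw [Fintype.prod_sum]

/-! ### Error-detecting codes -/

section Code

variable {n : ℕ}

theorem bitChar_eq_bitSign_dotProduct (k z : Fin n → ZMod 2) : bitChar k z = bitSign (k ⬝ᵥ z) := by
  rw [bitChar, dotProduct, bitSign_sum]

open Classical in
/-- The operator that maps the cosets `W` and `u + W` to the two basis states of a qubit. -/
def codeKraus (W : Submodule (ZMod 2) (Fin n → ZMod 2)) (u : Fin n → ZMod 2) :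
    Matrix (ZMod 2) (Fin n → ZMod 2) ℂ :=
  Matrix.of fun b X => if X + b • u ∈ W then 1 else 0

theorem star_codeKraus (W : Submodule (ZMod 2) (Fin n → ZMod 2)) (u : Fin n → ZMod 2) (b : ZMod 2)
    (X : Fin n → ZMod 2) : star (codeKraus W u b X) = codeKraus W u b X := by
  unfold codeKraus
  rw [Matrix.of_apply]
  split <;> simp

theorem smul_add_self (b : ZMod 2) (u X : Fin n → ZMod 2) : X + b • u + b • u = X := by
  funext i
  simp [add_assoc, CharTwo.add_self_eq_zero]

open Classical in
/-- The errors which the code `W` does not detect. -/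
def undetected (W : Submodule (ZMod 2) (Fin n → ZMod 2)) : Finset (Fin n → ZMod 2) :=
  Finset.univ.filter fun J => ∀ w ∈ W, J ⬝ᵥ w = 0

-- A character sums to zero over a coset of `W` unless it is trivial on `W`: errors violating a
-- parity check of `W` are filtered out.
open Classical in
theorem sum_codeKraus_mul_bitChar (W : Submodule (ZMod 2) (Fin n → ZMod 2)) (u : Fin n → ZMod 2)
    (J : Fin n → ZMod 2) (b : ZMod 2) :
    ∑ X, codeKraus W u b X * bitChar J X =
      if J ∈ undetected W then (Nat.card W : ℂ) * bitSign (b * (J ⬝ᵥ u)) else 0 := by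
  have h1 : ∑ X, codeKraus W u b X * bitChar J X =
      bitSign (b * (J ⬝ᵥ u)) * ∑ X : Fin n → ZMod 2, if X ∈ W then bitSign (J ⬝ᵥ X) else 0 := by
    rw [← Equiv.sum_comp (Equiv.addRight (b • u)), Finset.mul_sum]
    refine Finset.sum_congr rfl fun X _ => ?_
    simp only [codeKraus, Matrix.of_apply, Equiv.coe_addRight, smul_add_self, bitChar_add,
      bitChar_eq_bitSign_dotProduct, dotProduct_smul, smul_eq_mul]
    split <;> ring
  rw [h1]
  have h2 : (∑ X : Fin n → ZMod 2, if X ∈ W then bitSign (J ⬝ᵥ X) else 0) =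
      if J ∈ undetected W then (Nat.card W : ℂ) else 0 := by
    split
    · rename_i hJ
      simp only [undetected, Finset.mem_filter, Finset.mem_univ, true_and] at hJ
      have : ∀ X : Fin n → ZMod 2, (if X ∈ W then bitSign (J ⬝ᵥ X) else 0) =
          if X ∈ W then 1 else 0 := by
        intro X
        split
        · rename_i hX
          rw [hJ X hX, bitSign_zero]
        · rfl
      simp only [this, Finset.sum_boole]
      rw [Nat.card_eq_fintype_card, Fintype.card_subtype]
    · rename_i hJ
      simp only [undetected, Finset.mem_filter, Finset.mem_univ, true_and, not_forall] at hJ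
      obtain ⟨w, hw, hJw⟩ := hJ
      have hJ1 : J ⬝ᵥ w = 1 := (zmod_two_cases _).resolve_left hJw
      set S := ∑ X : Fin n → ZMod 2, if X ∈ W then bitSign (J ⬝ᵥ X) else 0 with hS
      -- Translation by a codeword `w` with `J ⬝ᵥ w = 1` permutes `W` and reverses every sign.
      have : S = -S := by
        rw [hS, ← Finset.sum_neg_distrib, ← Equiv.sum_comp (Equiv.addRight w)]
        refine Finset.sum_congr rfl fun X _ => ?_
        simp only [Equiv.coe_addRight, W.add_mem_iff_left hw, dotProduct_add, hJ1, bitSign_add,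
          bitSign_one]
        split <;> simp
      exact self_eq_neg.1 this
  rw [h2]
  split <;> ring

/-- The probability that an error is not detected. -/
def undetectedProb (W : Submodule (ZMod 2) (Fin n → ZMod 2)) (p : ℝ) : ℝ :=
  ∑ J ∈ undetected W, errorProb p J

/-- The dephasing of the encoded qubit, given that no error is detected. -/
def codeDamping (W : Submodule (ZMod 2) (Fin n → ZMod 2)) (u : Fin n → ZMod 2) (p : ℝ) : ℝ :=
  (∑ J ∈ undetected W, errorProb p J * (if J ⬝ᵥ u = 0 then 1 else -1)) / undetectedProb W p

theorem errorProb_nonneg {ι : Type} [Fintype ι] {p : ℝ} (h0 : 0 ≤ p) (h1 : p ≤ 1) (J : ι → ZMod 2) :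
    0 ≤ errorProb p J := by
  refine Finset.prod_nonneg fun i _ => ?_
  split <;> linarith

theorem errorProb_zero {ι : Type} [Fintype ι] (p : ℝ) :
    errorProb p (0 : ι → ZMod 2) = (1 - p) ^ Fintype.card ι := by
  simp [errorProb]

theorem zero_mem_undetected (W : Submodule (ZMod 2) (Fin n → ZMod 2)) : 0 ∈ undetected W := by
  simp [undetected]

theorem undetectedProb_eq (W : Submodule (ZMod 2) (Fin n → ZMod 2)) (p : ℝ) :
    undetectedProb W p = (1 - p) ^ n + ∑ J ∈ (undetected W).erase 0, errorProb p J := by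
  rw [undetectedProb, ← Finset.add_sum_erase _ _ (zero_mem_undetected W), errorProb_zero,
    Fintype.card_fin]

theorem undetectedProb_pos (W : Submodule (ZMod 2) (Fin n → ZMod 2)) {p : ℝ} (h0 : 0 ≤ p)
    (h1 : p < 1) : 0 < undetectedProb W p := by
  rw [undetectedProb_eq]
  have : 0 < (1 - p) ^ n := pow_pos (by linarith) n
  have := Finset.sum_nonneg fun J (_ : J ∈ (undetected W).erase 0) => errorProb_nonneg h0 h1.le J
  linarith

/-- If `E` is the probability of a nonzero undetected error, the damping is at least `((1-p)^n - E)
/ ((1-p)^n + E)`, the worst case being that every such error flips the encoded phase. -/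
theorem le_codeDamping (W : Submodule (ZMod 2) (Fin n → ZMod 2)) (u : Fin n → ZMod 2) {p δ : ℝ}
    (h0 : 0 ≤ p) (h1 : p < 1) (hδ : 0 ≤ δ)
    (h : ∑ J ∈ (undetected W).erase 0, errorProb p J ≤ δ * (1 - p) ^ n) :
    1 - 2 * δ ≤ codeDamping W u p := by
  have hpos := undetectedProb_pos W h0 h1
  rw [codeDamping, le_div_iff₀ hpos, ← Finset.add_sum_erase _ _ (zero_mem_undetected W),
    undetectedProb_eq, errorProb_zero, Fintype.card_fin]
  have h2 : -∑ J ∈ (undetected W).erase 0, errorProb p J ≤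
      ∑ J ∈ (undetected W).erase 0, errorProb p J * (if J ⬝ᵥ u = 0 then 1 else -1) := by
    rw [← Finset.sum_neg_distrib]
    refine Finset.sum_le_sum fun J _ => ?_
    have := errorProb_nonneg h0 h1.le J
    split <;> linarith
  have h3 := Finset.sum_nonneg fun J (_ : J ∈ (undetected W).erase 0) =>
    errorProb_nonneg h0 h1.le J
  have h4 := mul_nonneg hδ h3
  simp only [zero_dotProduct, if_true]
  nlinarith

/-- The coherence of the encoded qubit. -/
theorem sum_codeKraus_damping (W : Submodule (ZMod 2) (Fin n → ZMod 2)) (u : Fin n → ZMod 2) {p : ℝ}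
    (h0 : 0 ≤ p) (h1 : p < 1) (b b' : ZMod 2) :
    ∑ X, ∑ Y, codeKraus W u b X * (∏ i, damping (1 - 2 * p) (X i + Y i)) * star (codeKraus W u b' Y)
      = (((Nat.card W : ℝ) ^ 2 * undetectedProb W p : ℝ) : ℂ) *
        damping (codeDamping W u p) (b + b') := by
  classical
  -- The noise is expanded into errors `J`, each contributing a product of a character at `X` and
  -- one at `Y`, so that the two coset sums decouple.
  have hz : ∀ X Y : Fin n → ZMod 2, ∏ i, damping (1 - 2 * p) (X i + Y i) =
      ∑ J : Fin n → ZMod 2, (errorProb p J : ℂ) * (bitChar J X * bitChar J Y) := by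
    intro X Y
    rw [prod_damping_eq_sum p fun i => X i + Y i]
    refine Finset.sum_congr rfl fun J _ => ?_
    rw [← bitChar_add]; rfl
  have h2 : ∑ X, ∑ Y, codeKraus W u b X * (∏ i, damping (1 - 2 * p) (X i + Y i)) *
      star (codeKraus W u b' Y) = ∑ J : Fin n → ZMod 2, (errorProb p J : ℂ) *
        ((∑ X, codeKraus W u b X * bitChar J X) * ∑ Y, codeKraus W u b' Y * bitChar J Y) := by
    simp only [hz, star_codeKraus, Finset.sum_mul_sum]
    simp only [Finset.mul_sum, Finset.sum_mul]
    have : ∀ X, ∑ Y, ∑ J : Fin n → ZMod 2, codeKraus W u b X *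
        ((errorProb p J : ℂ) * (bitChar J X * bitChar J Y)) * codeKraus W u b' Y =
        ∑ J : Fin n → ZMod 2, ∑ Y, codeKraus W u b X *
        ((errorProb p J : ℂ) * (bitChar J X * bitChar J Y)) * codeKraus W u b' Y :=
      fun X => Finset.sum_comm
    simp only [this]
    rw [Finset.sum_comm]
    refine Finset.sum_congr rfl fun J _ => Finset.sum_congr rfl fun X _ =>
      Finset.sum_congr rfl fun Y _ => ?_
    ring
  rw [h2]
  simp only [sum_codeKraus_mul_bitChar]
  have h3 : ∀ J : Fin n → ZMod 2, (errorProb p J : ℂ) *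
      ((if J ∈ undetected W then (Nat.card W : ℂ) * bitSign (b * (J ⬝ᵥ u)) else 0) *
        if J ∈ undetected W then (Nat.card W : ℂ) * bitSign (b' * (J ⬝ᵥ u)) else 0) =
      if J ∈ undetected W then
        (Nat.card W : ℂ) ^ 2 * ((errorProb p J : ℂ) * bitSign ((b + b') * (J ⬝ᵥ u))) else 0 := by
    intro J
    rw [add_mul, bitSign_add]
    split <;> ring
  simp only [h3, Finset.sum_ite_mem, Finset.univ_inter, ← Finset.mul_sum]
  push_cast
  rw [mul_assoc]
  congr 1
  have hne : (undetectedProb W p : ℂ) ≠ 0 := by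
    exact_mod_cast (undetectedProb_pos W h0 h1).ne'
  rcases zmod_two_cases (b + b') with h | h
  · simp [h, damping, bitSign_zero, undetectedProb]
  · simp only [h, damping, one_mul, one_ne_zero, if_false, codeDamping, Complex.ofReal_div]
    rw [mul_div_cancel₀ _ hne]
    push_cast
    refine Finset.sum_congr rfl fun J _ => ?_
    unfold bitSign
    split <;> simp

end Code

/-! ### Existence of good pairs of codes -/

section Existence

variable {m n : ℕ} (e : Fin m ⊕ Unit ⊕ Fin m ≃ Fin n)

/-- The vector with the three blocks `s`, `c`, `t`. -/
def blockVec (s : Fin m → ZMod 2) (c : ZMod 2) (t : Fin m → ZMod 2) : Fin n → ZMod 2 :=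
  fun i => Sum.elim s (Sum.elim (fun _ => c) t) (e.symm i)

theorem blockVec_dotProduct (s : Fin m → ZMod 2) (c : ZMod 2) (t s' : Fin m → ZMod 2) (c' : ZMod 2)
    (t' : Fin m → ZMod 2) : blockVec e s c t ⬝ᵥ blockVec e s' c' t' =
      s ⬝ᵥ s' + (c * c' + t ⬝ᵥ t') := by
  rw [dotProduct, ← e.sum_comp]
  simp [blockVec, dotProduct, Fintype.sum_sum_type]

theorem exists_eq_blockVec (X : Fin n → ZMod 2) : ∃ s c t, X = blockVec e s c t := by
  refine ⟨fun i => X (e (.inl i)), X (e (.inr (.inl ()))), fun i => X (e (.inr (.inr i))), ?_⟩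
  funext i
  obtain ⟨j, rfl⟩ := e.surjective i
  rcases j with j | j | j <;> simp [blockVec]

theorem blockVec_zero : blockVec e 0 0 0 = 0 := by
  funext i
  obtain ⟨j, rfl⟩ := e.surjective i
  rcases j with j | j | j <;> simp [blockVec]

theorem blockVec_add (s : Fin m → ZMod 2) (c : ZMod 2) (t s' : Fin m → ZMod 2) (c' : ZMod 2)
    (t' : Fin m → ZMod 2) : blockVec e s c t + blockVec e s' c' t' =
      blockVec e (s + s') (c + c') (t + t') := by
  funext i
  obtain ⟨j, rfl⟩ := e.surjective i
  rcases j with j | j | j <;> simp [blockVec]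

theorem smul_blockVec (k : ZMod 2) (s : Fin m → ZMod 2) (c : ZMod 2) (t : Fin m → ZMod 2) :
    k • blockVec e s c t = blockVec e (k • s) (k • c) (k • t) := by
  funext i
  obtain ⟨j, rfl⟩ := e.surjective i
  rcases j with j | j | j <;> simp [blockVec]

/-- The code spanned by the vectors `(s, α ⬝ᵥ s, M *ᵥ s)`. -/
def leftCode (M : Matrix (Fin m) (Fin m) (ZMod 2)) (α : Fin m → ZMod 2) :
    Submodule (ZMod 2) (Fin n → ZMod 2) where
  carrier := {X | ∃ s, X = blockVec e s (α ⬝ᵥ s) (M *ᵥ s)}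
  zero_mem' := ⟨0, by simp [blockVec_zero]⟩
  add_mem' := by
    rintro _ _ ⟨s, rfl⟩ ⟨s', rfl⟩
    exact ⟨s + s', by rw [blockVec_add, dotProduct_add, Matrix.mulVec_add]⟩
  smul_mem' := by
    rintro k _ ⟨s, rfl⟩
    exact ⟨k • s, by rw [smul_blockVec, dotProduct_smul, Matrix.mulVec_smul]⟩

/-- The code spanned by the vectors `(M *ᵥ t, β ⬝ᵥ t, t)`. -/
def rightCode (M : Matrix (Fin m) (Fin m) (ZMod 2)) (β : Fin m → ZMod 2) :
    Submodule (ZMod 2) (Fin n → ZMod 2) where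
  carrier := {X | ∃ t, X = blockVec e (M *ᵥ t) (β ⬝ᵥ t) t}
  zero_mem' := ⟨0, by simp [blockVec_zero]⟩
  add_mem' := by
    rintro _ _ ⟨s, rfl⟩ ⟨s', rfl⟩
    exact ⟨s + s', by rw [blockVec_add, dotProduct_add, Matrix.mulVec_add]⟩
  smul_mem' := by
    rintro k _ ⟨s, rfl⟩
    exact ⟨k • s, by rw [smul_blockVec, dotProduct_smul, Matrix.mulVec_smul]⟩

/-- Orthogonality to the generators, one for each basis vector `s`, gives `m` parity checks that are
linear in the random parameters. -/
theorem eq_zero_of_mem_undetected_leftCode {M : Matrix (Fin m) (Fin m) (ZMod 2)}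
    {α a b : Fin m → ZMod 2} {c : ZMod 2} (h : blockVec e a c b ∈ undetected (leftCode e M α)) :
    a + c • α + b ᵥ* M = 0 := by
  simp only [undetected, Finset.mem_filter, Finset.mem_univ, true_and] at h
  funext i
  have := h _ ⟨Pi.single i 1, rfl⟩
  rw [blockVec_dotProduct, Matrix.dotProduct_mulVec] at this
  simpa [add_assoc] using this

theorem eq_zero_of_mem_undetected_rightCode {M : Matrix (Fin m) (Fin m) (ZMod 2)}
    {β a b : Fin m → ZMod 2} {c : ZMod 2} (h : blockVec e a c b ∈ undetected (rightCode e M β)) :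
    b + c • β + a ᵥ* M = 0 := by
  simp only [undetected, Finset.mem_filter, Finset.mem_univ, true_and] at h
  funext i
  have := h _ ⟨Pi.single i 1, rfl⟩
  rw [blockVec_dotProduct, Matrix.dotProduct_mulVec] at this
  simp only [dotProduct_single, mul_one] at this
  simp only [Pi.add_apply, Pi.smul_apply, smul_eq_mul, Pi.zero_apply]
  rw [← this]; ring

/-- If a quantity can be shifted arbitrarily by injective maps, it rarely vanishes. -/
theorem card_filter_mul_card_le {Θ S : Type*} [Fintype Θ] [Fintype S] [AddGroup S] (P : Θ → S)
    [DecidablePred fun θ => P θ = 0] (T : S → Θ → Θ) (hT : ∀ s, Function.Injective (T s))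
    (hP : ∀ s θ, P (T s θ) = P θ + s) :
    (Finset.univ.filter fun θ => P θ = 0).card * Fintype.card S ≤ Fintype.card Θ := by
  rw [← Finset.card_univ (α := S), ← Finset.card_product, ← Finset.card_univ (α := Θ)]
  -- From a zero `θ` of `P`, the shifted parameter `T s θ` has `P`-value `s`, so the pair `(θ, s)`
  -- can be recovered.
  refine Finset.card_le_card_of_injOn (fun z => T z.2 z.1) (fun _ _ => Finset.mem_univ _) ?_
  rintro ⟨θ, s⟩ h ⟨θ', s'⟩ h' heq
  simp only [Finset.coe_product, Set.mem_prod, Finset.coe_filter, Finset.mem_univ, true_and,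
    Set.mem_ofPred_eq] at h h'
  have h2 := congrArg P heq
  simp only [hP, h.1, h'.1, zero_add] at h2
  subst h2
  exact Prod.ext (hT s heq) rfl

/-- The parameters of the pairs of codes. -/
abbrev CodeParam (m : ℕ) : Type :=
  Matrix (Fin m) (Fin m) (ZMod 2) × (Fin m → ZMod 2) × (Fin m → ZMod 2)

/-- The first code of the pair. -/
def codeA (θ : CodeParam m) : Submodule (ZMod 2) (Fin n → ZMod 2) := leftCode e θ.1 θ.2.1

/-- The second code of the pair, which is orthogonal to the first one. -/
def codeB (θ : CodeParam m) : Submodule (ZMod 2) (Fin n → ZMod 2) :=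
  rightCode e (θ.1ᵀ + Matrix.vecMulVec θ.2.1 θ.2.2) θ.2.2

-- The check `a + c • α + b ᵥ* M = 0` is uniform in the parameters: for `c = 1` the vector `α`
-- shifts it arbitrarily, for `b ≠ 0` a row of `M` does. If both vanish it forces `a = 0`, excluded
-- since `J ≠ 0`.
open Classical in
theorem card_undetected_codeA {J : Fin n → ZMod 2} (hJ : J ≠ 0) :
    (Finset.univ.filter fun θ : CodeParam m => J ∈ undetected (codeA e θ)).card * 2 ^ m ≤
      Fintype.card (CodeParam m) := by
  obtain ⟨a, c, b, rfl⟩ := exists_eq_blockVec e J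
  have hcard : Fintype.card (Fin m → ZMod 2) = 2 ^ m := by simp [ZMod.card]
  rw [← hcard]
  set P : CodeParam m → Fin m → ZMod 2 := fun θ => a + c • θ.2.1 + b ᵥ* θ.1 with hP
  refine le_trans (Nat.mul_le_mul_right _ (Finset.card_le_card (t := Finset.univ.filter
    fun θ => P θ = 0) fun θ hθ => ?_)) ?_
  · rw [Finset.mem_filter] at hθ ⊢
    exact ⟨Finset.mem_univ _, eq_zero_of_mem_undetected_leftCode e hθ.2⟩
  rcases zmod_two_cases c with hc | hc
  · by_cases hb : b = 0
    · have : (Finset.univ.filter fun θ => P θ = 0) = ∅ := by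
        refine Finset.filter_eq_empty_iff.2 fun θ _ h => hJ ?_
        simp only [hP, hc, hb, zero_smul, add_zero, Matrix.zero_vecMul] at h
        rw [h, hc, hb, blockVec_zero]
      rw [this]; simp
    · obtain ⟨i, hi⟩ := Function.ne_iff.1 hb
      have hi1 : b i = 1 := (zmod_two_cases _).resolve_left hi
      refine card_filter_mul_card_le P
        (fun s θ => (θ.1 + Matrix.vecMulVec (Pi.single i 1) s, θ.2)) ?_ ?_
      · rintro s ⟨M, α⟩ ⟨M', α'⟩ h
        simpa using h
      · intro s θ
        simp only [hP, Matrix.vecMul_add, Matrix.vecMul_vecMulVec]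
        simp [hi1, add_assoc]
  · refine card_filter_mul_card_le P (fun s θ => (θ.1, θ.2.1 + s, θ.2.2)) ?_ ?_
    · rintro s ⟨M, α, β⟩ ⟨M', α', β'⟩ h
      simpa using h
    · intro s θ
      simp only [hP, hc, one_smul]
      abel

-- The argument for the first code is repeated with its blocks exchanged.
open Classical in
theorem card_undetected_codeB {J : Fin n → ZMod 2} (hJ : J ≠ 0) :
    (Finset.univ.filter fun θ : CodeParam m => J ∈ undetected (codeB e θ)).card * 2 ^ m ≤
      Fintype.card (CodeParam m) := by
  obtain ⟨a, c, b, rfl⟩ := exists_eq_blockVec e J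
  have hcard : Fintype.card (Fin m → ZMod 2) = 2 ^ m := by simp [ZMod.card]
  rw [← hcard]
  set P : CodeParam m → Fin m → ZMod 2 := fun θ =>
    b + c • θ.2.2 + a ᵥ* (θ.1ᵀ + Matrix.vecMulVec θ.2.1 θ.2.2) with hP
  refine le_trans (Nat.mul_le_mul_right _ (Finset.card_le_card (t := Finset.univ.filter
    fun θ => P θ = 0) fun θ hθ => ?_)) ?_
  · rw [Finset.mem_filter] at hθ ⊢
    exact ⟨Finset.mem_univ _, eq_zero_of_mem_undetected_rightCode e hθ.2⟩
  -- The block `a` is examined first, because for `a ≠ 0` a shift of `β` would also change the term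
  -- containing `α` and `β` together. A column of `M` shifts the check cleanly.
  by_cases ha : a = 0
  · rcases zmod_two_cases c with hc | hc
    · have : (Finset.univ.filter fun θ => P θ = 0) = ∅ := by
        refine Finset.filter_eq_empty_iff.2 fun θ _ h => hJ ?_
        simp only [hP, hc, ha, zero_smul, add_zero, Matrix.zero_vecMul] at h
        rw [h, hc, ha, blockVec_zero]
      rw [this]; simp
    · refine card_filter_mul_card_le P (fun s θ => (θ.1, θ.2.1, θ.2.2 + s)) ?_ ?_
      · rintro s ⟨M, α, β⟩ ⟨M', α', β'⟩ h
        simpa using h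
      · intro s θ
        simp only [hP, hc, ha, one_smul, Matrix.zero_vecMul]
        abel
  · obtain ⟨i, hi⟩ := Function.ne_iff.1 ha
    have hi1 : a i = 1 := (zmod_two_cases _).resolve_left hi
    refine card_filter_mul_card_le P
      (fun s θ => (θ.1 + Matrix.vecMulVec s (Pi.single i 1), θ.2)) ?_ ?_
    · rintro s ⟨M, α⟩ ⟨M', α'⟩ h
      simpa using h
    · intro s θ
      simp only [hP, Matrix.vecMul_add, Matrix.transpose_add, Matrix.transpose_vecMulVec,
        Matrix.vecMul_vecMulVec]
      simp only [dotProduct_single, hi1, mul_one, one_smul]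
      abel

theorem sum_errorProb (p : ℝ) : ∑ J : Fin n → ZMod 2, errorProb p J = 1 := by
  unfold errorProb
  rw [← Fintype.prod_sum fun (_ : Fin n) (b : ZMod 2) => if b = 1 then p else 1 - p]
  simp [sum_zmod_two]

/-- A first-moment bound: exchanging the sums, each nonzero error is undetected for at most the
fraction `1 / N` of the codes, and the error probabilities add up to one. -/
theorem sum_undetected_le {p : ℝ} (h0 : 0 ≤ p) (h1 : p ≤ 1) {Θ : Type} [Fintype Θ]
    (W : Θ → Submodule (ZMod 2) (Fin n → ZMod 2)) (N : ℝ) (hN : 0 < N)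
    (hW : ∀ J ≠ 0, open Classical in
      ((Finset.univ.filter fun θ => J ∈ undetected (W θ)).card : ℝ) * N ≤ Fintype.card Θ) :
    ∑ θ, ∑ J ∈ (undetected (W θ)).erase 0, errorProb p J ≤ Fintype.card Θ / N := by
  classical
  have h2 : ∀ θ, ∑ J ∈ (undetected (W θ)).erase 0, errorProb p J =
      ∑ J : Fin n → ZMod 2, if J ≠ 0 ∧ J ∈ undetected (W θ) then errorProb p J else 0 := by
    intro θ
    rw [← Finset.sum_filter]
    refine Finset.sum_congr ?_ fun _ _ => rfl
    ext J; simp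
  simp only [h2]
  rw [Finset.sum_comm]
  have h3 : ∀ J : Fin n → ZMod 2, (∑ θ, if J ≠ 0 ∧ J ∈ undetected (W θ) then errorProb p J else 0) ≤
      errorProb p J * (Fintype.card Θ / N) := by
    intro J
    have hJ0 := errorProb_nonneg h0 h1 J
    by_cases hJ : J = 0
    · simp only [hJ, ne_eq, not_true_eq_false, false_and, if_false, Finset.sum_const_zero]
      rw [hJ] at hJ0
      positivity
    · simp only [ne_eq, hJ, not_false_eq_true, true_and]
      rw [← Finset.sum_filter, Finset.sum_const, nsmul_eq_mul, mul_comm]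
      refine mul_le_mul_of_nonneg_left ?_ hJ0
      rw [le_div_iff₀ hN]
      exact hW J hJ
  refine (Finset.sum_le_sum fun J _ => h3 J).trans ?_
  rw [← Finset.sum_mul, sum_errorProb, one_mul]

/-- Averaging over the parameters makes both codes good at once, while the orthogonality relations
hold for every choice of parameters. -/
theorem exists_codes {p δ : ℝ} (h0 : 0 ≤ p) (h1 : p < 1) (h : 1 / 2 < (1 - p) ^ 2) (hδ : 0 < δ) :
    ∃ (n : ℕ) (W W' : Submodule (ZMod 2) (Fin n → ZMod 2)) (u u' : Fin n → ZMod 2),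
      (∀ w ∈ W, ∀ w' ∈ W', w ⬝ᵥ w' = 0) ∧ (∀ w' ∈ W', u ⬝ᵥ w' = 0) ∧ (∀ w ∈ W, w ⬝ᵥ u' = 0) ∧
      u ⬝ᵥ u' = 1 ∧ ∑ J ∈ (undetected W).erase 0, errorProb p J ≤ δ * (1 - p) ^ n ∧
      ∑ J ∈ (undetected W').erase 0, errorProb p J ≤ δ * (1 - p) ^ n := by
  have hp : 0 < 1 - p := by linarith
  -- It must hold that `2 / 2^m ≤ δ (1-p)^(2m+1)`, which is possible because `2(1-p)² > 1`.
  obtain ⟨m, hm⟩ := pow_unbounded_of_one_lt (2 / (δ * (1 - p)))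
    (show 1 < 2 * (1 - p) ^ 2 by linarith)
  have hn : Fintype.card (Fin m ⊕ Unit ⊕ Fin m) = 2 * m + 1 := by simp; ring
  let e := Fintype.equivFinOfCardEq hn
  have hA := sum_undetected_le h0 h1.le (codeA e) (2 ^ m) (by positivity)
    fun J hJ => by exact_mod_cast card_undetected_codeA e hJ
  have hB := sum_undetected_le h0 h1.le (codeB e) (2 ^ m) (by positivity)
    fun J hJ => by exact_mod_cast card_undetected_codeB e hJ
  have hnn : ∀ W : Submodule (ZMod 2) (Fin (2 * m + 1) → ZMod 2),
      0 ≤ ∑ J ∈ (undetected W).erase 0, errorProb p J := fun W =>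
    Finset.sum_nonneg fun J _ => errorProb_nonneg h0 h1.le J
  -- The sum of the two undetected probabilities has mean at most `2 / 2^m`, so some `θ` achieves
  -- this for the sum and hence for each summand.
  obtain ⟨θ, -, hθ⟩ := Finset.exists_le_of_sum_le (s := (Finset.univ : Finset (CodeParam m)))
    (f := fun θ => ∑ J ∈ (undetected (codeA e θ)).erase 0, errorProb p J +
      ∑ J ∈ (undetected (codeB e θ)).erase 0, errorProb p J) (g := fun _ => 2 / 2 ^ m)
    ⟨0, Finset.mem_univ _⟩ (by
      rw [Finset.sum_add_distrib, Finset.sum_const, Finset.card_univ, nsmul_eq_mul]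
      calc _ ≤ (Fintype.card (CodeParam m) : ℝ) / 2 ^ m + Fintype.card (CodeParam m) / 2 ^ m :=
            add_le_add hA hB
        _ = _ := by ring)
  have hbound : 2 / 2 ^ m ≤ δ * (1 - p) ^ (2 * m + 1) := by
    rw [div_lt_iff₀ (by positivity)] at hm
    rw [div_le_iff₀ (by positivity)]
    calc 2 ≤ (2 * (1 - p) ^ 2) ^ m * (δ * (1 - p)) := hm.le
      _ = _ := by rw [mul_pow, pow_succ (1 - p) (2 * m), pow_mul]; ring
  -- The shifts are `(0, 1, β)` and `(α, 1, 0)`. The middle coordinate cancels the outer block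
  -- against the opposite code and gives the shifts inner product one.
  refine ⟨2 * m + 1, codeA e θ, codeB e θ, blockVec e 0 1 θ.2.2, blockVec e θ.2.1 1 0,
    ?_, ?_, ?_, ?_, ?_, ?_⟩
  · rintro _ ⟨s, rfl⟩ _ ⟨t, rfl⟩
    rw [blockVec_dotProduct, Matrix.add_mulVec, dotProduct_add, Matrix.dotProduct_mulVec,
      Matrix.vecMul_transpose, Matrix.vecMulVec_mulVec]
    have : s ⬝ᵥ MulOpposite.op (θ.2.2 ⬝ᵥ t) • θ.2.1 = (θ.2.1 ⬝ᵥ s) * (θ.2.2 ⬝ᵥ t) := by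
      rw [dotProduct_smul, op_smul_eq_smul, smul_eq_mul, dotProduct_comm s, mul_comm]
    rw [this]
    generalize (θ.1 *ᵥ s) ⬝ᵥ t = x, (θ.2.1 ⬝ᵥ s) * (θ.2.2 ⬝ᵥ t) = y
    revert x y
    decide
  · rintro _ ⟨t, rfl⟩
    rw [blockVec_dotProduct, zero_dotProduct, one_mul, zero_add, CharTwo.add_self_eq_zero]
  · rintro _ ⟨s, rfl⟩
    rw [blockVec_dotProduct, dotProduct_zero, mul_one, add_zero, dotProduct_comm,
      CharTwo.add_self_eq_zero]
  · rw [blockVec_dotProduct]; simp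
  · have := hnn (codeB e θ); linarith
  · have := hnn (codeA e θ); linarith

end Existence

/-! ### Measuring out all qubits away from an edge -/

section GraphSign

variable {V : Type} [Fintype V] [DecidableEq V] (G : SimpleGraph V) [DecidableRel G.Adj]

/-- Each edge is the image of exactly two ordered pairs, its two orientations. -/
theorem prod_edgeFinset_eq_prod_adj (f : V → V → ℂ) (g : Sym2 V → ℂ)
    (hg : ∀ a b, g s(a, b) = f a b * f b a) :
    ∏ e ∈ G.edgeFinset, g e = ∏ v, ∏ w, if G.Adj v w then f v w else 1 := by
  rw [← Fintype.prod_prod_type' (f := fun v w => if G.Adj v w then f v w else 1),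
    ← Finset.prod_filter, ← Finset.prod_fiberwise_of_maps_to (t := G.edgeFinset)
      (g := fun z : V × V => s(z.1, z.2))]
  · refine Finset.prod_congr rfl fun e he => ?_
    induction e using Sym2.ind with
    | _ a b =>
      rw [SimpleGraph.mem_edgeFinset, SimpleGraph.mem_edgeSet] at he
      have : (Finset.univ.filter fun z : V × V => G.Adj z.1 z.2).filter
          (fun z => s(z.1, z.2) = s(a, b)) = {(a, b), (b, a)} := by
        ext ⟨c, d⟩
        simp only [Finset.mem_filter, Finset.mem_univ, true_and, Sym2.eq_iff, Finset.mem_insert,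
          Finset.mem_singleton, Prod.mk.injEq]
        constructor
        · exact fun h => h.2
        · rintro (⟨rfl, rfl⟩ | ⟨rfl, rfl⟩)
          · exact ⟨he, Or.inl ⟨rfl, rfl⟩⟩
          · exact ⟨he.symm, Or.inr ⟨rfl, rfl⟩⟩
      rw [this, Finset.prod_pair (by simp [he.ne]), hg]
  · rintro ⟨c, d⟩ h
    simpa using h

/-- The exponent of `graphSign` is a quadratic form over `ZMod 2`; the last factor is its polar
form, summed over ordered adjacent pairs. -/
theorem graphSign_add (x y : V → ZMod 2) :
    graphSign G (x + y) = graphSign G x * graphSign G y *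
      ∏ v, ∏ w, if G.Adj v w then bitSign (x v * y w) else 1 := by
  have h := prod_edgeFinset_eq_prod_adj G (fun v w => bitSign (x v * y w))
    (fun e => edgeSign e (x + y) * (edgeSign e x * edgeSign e y)) (by
      intro a b
      simp only [edgeSign_mk, Pi.add_apply, ← bitSign_add]
      congr 1
      generalize x a = p, x b = q, y a = r, y b = s
      revert p q r s
      decide)
  rw [← h, Finset.prod_mul_distrib, Finset.prod_mul_distrib]
  change _ = _ * (graphSign G (x + y) * (graphSign G x * graphSign G y))
  have hx := graphSign_mul_self G x
  have hy := graphSign_mul_self G y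
  calc graphSign G (x + y) = graphSign G (x + y) * (graphSign G x * graphSign G x) *
      (graphSign G y * graphSign G y) := by rw [hx, hy, mul_one, mul_one]
    _ = _ := by ring

theorem graphSign_of_support {e : Sym2 V} (he : e ∈ G.edgeFinset) (z : V → ZMod 2)
    (hz : ∀ v, v ∉ e → z v = 0) : graphSign G z = edgeSign e z := by
  rw [graphSign, Finset.prod_eq_single e]
  · intro f hf hfe
    induction f using Sym2.ind with
    | _ a b =>
      rw [edgeSign_mk]
      rw [SimpleGraph.mem_edgeFinset, SimpleGraph.mem_edgeSet] at hf
      by_cases ha : a ∈ e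
      · by_cases hb : b ∈ e
        · exact absurd ((Sym2.mem_and_mem_iff hf.ne).1 ⟨ha, hb⟩).symm hfe
        · rw [hz b hb, mul_zero, bitSign_zero]
      · rw [hz a ha, zero_mul, bitSign_zero]
  · exact fun h => absurd he h

/-- The corrections after measuring the qubits away from `e` leave only the controlled-phase gate
along `e`. -/
theorem graphSign_mul_correction {e : Sym2 V} (he : e ∈ G.edgeFinset) (z : V → ZMod 2) :
    graphSign G z * (∏ v, if v ∈ e then
        bitSign (z v * ∑ w, if G.Adj v w ∧ w ∉ e then z w else 0) else 1) =
      edgeSign e z * graphSign G fun w => if w ∈ e then 0 else z w := by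
  set x : V → ZMod 2 := fun w => if w ∈ e then z w else 0 with hx
  set y : V → ZMod 2 := fun w => if w ∈ e then 0 else z w with hy
  -- Here `x` lives on the two ends of `e` and `y` on the measured qubits. The polar form of `x` and
  -- `y` is exactly the correction, so it cancels.
  have hz : z = x + y := by
    funext w
    simp only [hx, hy, Pi.add_apply]
    split <;> simp
  have hc : (∏ v, if v ∈ e then
      bitSign (z v * ∑ w, if G.Adj v w ∧ w ∉ e then z w else 0) else 1) =
      ∏ v, ∏ w, if G.Adj v w then bitSign (x v * y w) else 1 := by
    refine Finset.prod_congr rfl fun v _ => ?_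
    by_cases hv : v ∈ e
    · rw [if_pos hv, Finset.mul_sum, bitSign_sum]
      refine Finset.prod_congr rfl fun w _ => ?_
      by_cases hvw : G.Adj v w <;> by_cases hw : w ∈ e <;> simp [hvw, hw, hx, hy, hv, bitSign_zero]
    · simp [hv, hx, bitSign_zero]
  have hxe : edgeSign e z = graphSign G x := by
    rw [graphSign_of_support G he x fun v hv => if_neg hv]
    unfold edgeSign
    have : (∀ v ∈ e, z v = 1) ↔ ∀ v ∈ e, x v = 1 := by
      refine forall₂_congr fun v hv => ?_
      simp [hx, hv]
    by_cases h : ∀ v ∈ e, x v = 1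
    · rw [if_pos h, if_pos (this.2 h)]
    · rw [if_neg h, if_neg fun h' => h (this.1 h')]
  rw [hc, hxe]
  conv_lhs => rw [hz, graphSign_add]
  rw [mul_assoc, ← Finset.prod_mul_distrib]
  have : ∀ v, (∏ w, if G.Adj v w then bitSign (x v * y w) else 1) *
      (∏ w, if G.Adj v w then bitSign (x v * y w) else 1) = 1 := by
    intro v
    rw [← Finset.prod_mul_distrib]
    refine Finset.prod_eq_one fun w _ => ?_
    split
    · exact bitSign_mul_self _
    · exact one_mul _
  simp only [this, Finset.prod_const_one, mul_one]

end GraphSign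

/-! ### Copies of the noisy state -/

theorem copies_noisyGraphState {V C : Type} [Fintype V] [DecidableEq V] [Fintype C]
    (G : SimpleGraph V) [DecidableRel G.Adj] (p : ℝ) :
    copies C (noisyGraphState G p) = Matrix.of fun X Y : ∀ v, Copies V C v =>
      (∏ c, graphState G fun v => X v c) * star (∏ c, graphState G fun v => Y v c) *
        ∏ v, ∏ c, damping (1 - 2 * p) (X v c + Y v c) := by
  ext X Y
  simp only [copies, noisyGraphState_eq_dephased, dephased, Matrix.of_apply,
    Finset.prod_mul_distrib, star_prod, star_graphState]
  rw [Finset.prod_comm]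

/-! ### The two-party protocol -/

/-- A pair of mutually orthogonal codes, each encoding one qubit. -/
structure CodePair (n : ℕ) where
  /-- the two codes -/
  space : Bool → Submodule (ZMod 2) (Fin n → ZMod 2)
  /-- the encoded bit flips -/
  shift : Bool → Fin n → ZMod 2
  space_orth : ∀ r, ∀ w ∈ space r, ∀ w' ∈ space (!r), w ⬝ᵥ w' = 0
  shift_orth : ∀ r, ∀ w ∈ space (!r), shift r ⬝ᵥ w = 0
  shift_dot : ∀ r, shift r ⬝ᵥ shift (!r) = 1

namespace CodePair

variable {n : ℕ} (c : CodePair n)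

/-- The relations of the pair leave only the product of the shift components, as a finite check over
bits confirms. -/
theorem dotProduct_eq (r : Bool) {b b' : ZMod 2} {X Y : Fin n → ZMod 2}
    (hX : X + b • c.shift r ∈ c.space r) (hY : Y + b' • c.shift (!r) ∈ c.space (!r)) :
    X ⬝ᵥ Y = b * b' := by
  have h1 := c.space_orth r _ hX _ hY
  have h2 := c.shift_orth r _ hY
  have h3 := c.shift_orth (!r) _ (by rw [Bool.not_not]; exact hX)
  rw [dotProduct_comm] at h3
  have h4 := c.shift_dot r
  simp only [add_dotProduct, dotProduct_add, smul_dotProduct, dotProduct_smul, smul_eq_mul, h4]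
    at h1 h2 h3
  generalize X ⬝ᵥ Y = d, X ⬝ᵥ c.shift (!r) = f, c.shift r ⬝ᵥ Y = g at *
  clear hX hY
  revert h1 h2 h3
  revert b b' d f g
  decide

/-- The operator of a party. -/
abbrev kraus (r : Bool) : Matrix (ZMod 2) (Fin n → ZMod 2) ℂ := codeKraus (c.space r) (c.shift r)

/-- On the accepted cosets, the transversal controlled-phase gates act as one gate between the
encoded bits. -/
theorem kraus_mul_kraus_mul_bitSign (r : Bool) (b b' : ZMod 2) (X Y : Fin n → ZMod 2) :
    c.kraus r b X * c.kraus (!r) b' Y * bitSign (X ⬝ᵥ Y) =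
      c.kraus r b X * c.kraus (!r) b' Y * bitSign (b * b') := by
  classical
  simp only [kraus, codeKraus, Matrix.of_apply]
  by_cases hX : X + b • c.shift r ∈ c.space r
  · by_cases hY : Y + b' • c.shift (!r) ∈ c.space (!r)
    · rw [c.dotProduct_eq r hX hY]
    · simp [hY]
  · simp [hX]

/-- The dephasing of the output of a party. -/
abbrev damp (p : ℝ) (r : Bool) : ℝ := codeDamping (c.space r) (c.shift r) p

/-- The weight of the output of a party. -/
def weight (p : ℝ) (r : Bool) : ℝ := (Nat.card (c.space r) : ℝ) ^ 2 * undetectedProb (c.space r) p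

theorem weight_pos {p : ℝ} (h0 : 0 ≤ p) (h1 : p < 1) (r : Bool) : 0 < c.weight p r := by
  have := undetectedProb_pos (c.space r) h0 h1
  have h2 : 0 < Nat.card (c.space r) := Nat.card_pos
  unfold weight
  positivity

theorem sum_kraus_damping {p : ℝ} (h0 : 0 ≤ p) (h1 : p < 1) (r : Bool) (b b' : ZMod 2) :
    ∑ X, ∑ Y, c.kraus r b X * (∏ i, damping (1 - 2 * p) (X i + Y i)) * star (c.kraus r b' Y) =
      (c.weight p r : ℂ) * damping (c.damp p r) (b + b') :=
  sum_codeKraus_damping _ _ h0 h1 b b'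

end CodePair

theorem exists_codePair {p δ : ℝ} (h0 : 0 ≤ p) (h1 : p < 1) (h : 1 / 2 < (1 - p) ^ 2) (hδ : 0 < δ) :
    ∃ (n : ℕ) (c : CodePair n), ∀ r, 1 - δ ≤ c.damp p r := by
  obtain ⟨n, W, W', u, u', hWW, hu, hu', huu, hW, hW'⟩ := exists_codes h0 h1 h (half_pos hδ)
  refine ⟨n, { space := fun r => if r then W else W'
               shift := fun r => if r then u else u'
               space_orth := ?_, shift_orth := ?_, shift_dot := ?_ }, ?_⟩
  · rintro (_ | _) w hw w' hw'
    · rw [dotProduct_comm]; exact hWW w' hw' w hw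
    · exact hWW w hw w' hw'
  · rintro (_ | _) w hw
    · change u' ⬝ᵥ w = 0
      rw [dotProduct_comm]; exact hu' w hw
    · exact hu w hw
  · rintro (_ | _)
    · change u' ⬝ᵥ u = 1
      rw [dotProduct_comm]; exact huu
    · exact huu
  · rintro (_ | _)
    · have := le_codeDamping W' u' h0 h1 (half_pos hδ).le hW'
      change 1 - δ ≤ codeDamping W' u' p
      linarith
    · have := le_codeDamping W u h0 h1 (half_pos hδ).le hW
      change 1 - δ ≤ codeDamping W u p
      linarith

/-- The role of a vertex in the two-party protocol for the edge `e`. -/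
def role {V : Type} [DecidableEq V] (e : Sym2 V) (v : V) : Bool := decide (v = (Quot.out e).1)

/-- The orientation of an edge is an arbitrary choice of representative, but it gives its two ends
opposite codes. -/
theorem role_mk {V : Type} [DecidableEq V] {a b : V} (hab : a ≠ b) :
    role s(a, b) b = !role s(a, b) a := by
  have h : s((Quot.out s(a, b)).1, (Quot.out s(a, b)).2) = s(a, b) := Quot.out_eq _
  unfold role
  rw [Sym2.eq_iff] at h
  rcases h with ⟨h1, h2⟩ | ⟨h1, h2⟩ <;> simp [h1, hab, hab.symm]

theorem damping_prod {ι : Type*} (s : Finset ι) (q : ι → ℝ) (z : ZMod 2) :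
    ∏ i ∈ s, damping (q i) z = damping (∏ i ∈ s, q i) z := by
  unfold damping
  split <;> simp

/-- The two-party operators turn noisy pairs into a less noisy pair. -/
theorem conj_copies_two_party {U : Type} [Fintype U] [DecidableEq U] {n : ℕ} (c : CodePair n)
    (r : U → Bool) {a b : U} (hab : a ≠ b) (hU : ∀ v, v = a ∨ v = b) (hr : r b = !r a) (k : U → ℝ)
    {p : ℝ} (h0 : 0 ≤ p) (h1 : p < 1) :
    tensorOp (fun v => (k v : ℂ) • c.kraus (r v)) *
        copies (Fin n) (noisyGraphState (⊤ : SimpleGraph U) p) *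
        (tensorOp fun v => (k v : ℂ) • c.kraus (r v))ᴴ =
      (((1 / 4) ^ n * 4 * ∏ v, k v ^ 2 * c.weight p (r v) : ℝ) : ℂ) •
        dephased (⊤ : SimpleGraph U) fun v => c.damp p (r v) := by
  have huniv : (Finset.univ : Finset U) = {a, b} := by
    ext v; simpa using hU v
  have hprod : ∀ f : U → ℂ, ∏ v, f v = f a * f b := fun f => by
    rw [huniv, Finset.prod_pair hab]
  have hcard : Fintype.card U = 2 := by
    rw [← Finset.card_univ, huniv, Finset.card_pair hab]
  have hsign : ∀ x : U → ZMod 2, graphSign ⊤ x = bitSign (x a * x b) := by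
    intro x
    rw [← edgeSign_mk]
    refine graphSign_of_support ⊤ (by simp [hab]) x fun v hv => ?_
    rcases hU v with rfl | rfl <;> simp at hv
  have hstate : ∀ x : U → ZMod 2, graphState ⊤ x = 1 / 2 * bitSign (x a * x b) := by
    intro x
    rw [graphState_eq, hsign, hcard, sq, inv_sqrt_two_mul_self]
  ext x y
  rw [copies_noisyGraphState]
  refine (conj_tensorOp_of_support (d := Copies U (Fin n)) (m := Qubits U)
    (fun v => (k v : ℂ) • c.kraus (r v)) (fun v => (k v : ℂ) • c.kraus (r v))
    (fun X => ∏ i, graphState ⊤ fun v => X v i) (fun x => (1 / 2) ^ n * bitSign (x a * x b))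
    (fun _ X Y => ∏ i, damping (1 - 2 * p) (X i + Y i)) ?_ x y).trans ?_
  rotate_left
  · have hv : ∀ v, ∑ X, ∑ Y, ((k v : ℂ) • c.kraus (r v)) (x v) X *
        (∏ i, damping (1 - 2 * p) (X i + Y i)) * star (((k v : ℂ) • c.kraus (r v)) (y v) Y) =
        ((k v ^ 2 * c.weight p (r v) : ℝ) : ℂ) * damping (c.damp p (r v)) (x v + y v) := by
      intro v
      rw [Complex.ofReal_mul, mul_assoc, ← c.sum_kraus_damping h0 h1, Finset.mul_sum]
      refine Finset.sum_congr rfl fun X _ => ?_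
      rw [Finset.mul_sum]
      refine Finset.sum_congr rfl fun Y _ => ?_
      simp only [Matrix.smul_apply, smul_eq_mul, star_mul', Complex.star_def, Complex.conj_ofReal]
      push_cast
      ring
    simp only [hv]
    rw [Finset.prod_mul_distrib, Matrix.smul_apply, dephased, Matrix.of_apply, hstate, hstate]
    simp only [star_mul', star_bitSign, smul_eq_mul]
    push_cast
    have h4 : (1 / 4 : ℂ) ^ n = (1 / 2) ^ n * (1 / 2) ^ n := by rw [← mul_pow]; norm_num
    have hs : star ((1 / 2 : ℂ) ^ n) = (1 / 2) ^ n := by simp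
    rw [h4, hs]
    ring
  · intro x X
    simp only [hprod, hstate, Finset.prod_mul_distrib, Finset.prod_const, Finset.card_univ,
      Fintype.card_fin, ← bitSign_sum, Matrix.smul_apply, smul_eq_mul]
    have := c.kraus_mul_kraus_mul_bitSign (r a) (x a) (x b) (X a) (X b)
    rw [hr]
    change _ * (_ * bitSign (X a ⬝ᵥ X b)) = _
    linear_combination (k a : ℂ) * (k b : ℂ) * (1 / 2) ^ n * this

/-! ### Protocols with a single accepted run -/

theorem SLOCC.apply_last_of_accept_iff {V : Type} [Fintype V] [DecidableEq V] {e : V → Type}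
    [∀ v, Fintype (e v)] {d : V → Type} [∀ v, Fintype (d v)] (R : LocalRound d e)
    (accept : (∀ v, R.Outcome v) → Bool) (o : ∀ v, R.Outcome v)
    (h : ∀ o', accept o' = true ↔ o' = o) (ρ : Matrix (∀ v, d v) (∀ v, d v) ℂ) :
    (SLOCC.last R accept).apply ρ =
      tensorOp (fun v => R.kraus v (o v)) * ρ * (tensorOp fun v => R.kraus v (o v))ᴴ := by
  rw [SLOCC.apply_last, Finset.sum_eq_single o]
  · rw [if_pos ((h o).2 rfl)]
  · intro o' _ ho'
    rw [if_neg fun hc => ho' ((h o').1 hc)]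
  · exact fun hc => absurd (Finset.mem_univ o) hc

theorem conj_conj {l m n : Type*} [Fintype l] [Fintype m] [Fintype n] (A : Matrix l m ℂ)
    (B : Matrix m n ℂ) (ρ : Matrix n n ℂ) : A * (B * ρ * Bᴴ) * Aᴴ = (A * B) * ρ * (A * B)ᴴ := by
  rw [Matrix.conjTranspose_mul]
  simp only [Matrix.mul_assoc]

/-- If each subprotocol and the final round accept one outcome only, both sums over runs collapse
and the protocol becomes conjugation by one product operator. -/
theorem apply_parThen_zero {V J : Type} [Fintype V] [DecidableEq V] [Fintype J] [DecidableEq J]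
    (I : V → J → Prop) [∀ v j, Decidable (I v j)] {d m : ∀ j, {v // I v j} → Type}
    [∀ j v, Fintype (d j v)] [∀ j v, Fintype (m j v)] {e : V → Type} [∀ v, Fintype (e v)]
    (R : LocalRound (fun v => ∀ j : {j // I v j}, m j.1 ⟨v, j.2⟩) e)
    (acc : (∀ v, R.Outcome v) → Bool) (t : ∀ v, R.Outcome v) (ht : ∀ t', acc t' = true ↔ t' = t)
    (S : ∀ j, LocalRound (d j) (m j)) (accS : ∀ j, (∀ v, (S j).Outcome v) → Bool)
    (o : ∀ j v, (S j).Outcome v) (ho : ∀ j o', accS j o' = true ↔ o' = o j)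
    (ρ : Matrix (∀ v, ∀ j : {j // I v j}, d j.1 ⟨v, j.2⟩)
      (∀ v, ∀ j : {j // I v j}, d j.1 ⟨v, j.2⟩) ℂ) :
    (parThen I R acc 0 fun j => SLOCC.last (S j) (accS j)).apply ρ =
      tensorOp (fun v => R.kraus v (t v) * (parRound I S).kraus v fun j => o j.1 ⟨v, j.2⟩) * ρ *
        (tensorOp fun v => R.kraus v (t v) * (parRound I S).kraus v fun j => o j.1 ⟨v, j.2⟩)ᴴ := by
  refine (SLOCC.apply_step _ _ _ _ ρ).trans ?_
  refine (Fintype.sum_eq_single (fun v (j : {j // I v j}) => o j.1 ⟨v, j.2⟩) ?_).trans ?_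
  · intro o' ho'
    rw [SLOCC.apply_last]
    refine Finset.sum_eq_zero fun t' _ => if_neg fun hc => ho' ?_
    rw [Bool.and_eq_true, decide_eq_true_iff] at hc
    funext v j
    exact congrFun ((ho j.1 _).1 (hc.1 j.1)) ⟨v, j.2⟩
  · refine (SLOCC.apply_last_of_accept_iff _ _ t ?_ _).trans ?_
    · intro t'
      rw [Bool.and_eq_true, ht, decide_eq_true_iff]
      exact and_iff_right fun j => (ho j _).2 rfl
    · rw [conj_conj, tensorOp_mul]
      rfl

theorem mul_apply_of_indicator_left {l m k : Type*} [Fintype m] (A : Matrix l m ℂ)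
    (B : Matrix m k ℂ) (b : l) (x₀ : m) [∀ x, Decidable (x = x₀)] (c : ℂ)
    (hA : ∀ x, A b x = if x = x₀ then c else 0) (y : k) : (A * B) b y = c * B x₀ y := by
  rw [Matrix.mul_apply, Finset.sum_eq_single x₀]
  · rw [hA, if_pos rfl]
  · intro x _ hx
    rw [hA, if_neg hx, zero_mul]
  · exact fun h => absurd (Finset.mem_univ _) h

theorem mul_apply_of_indicator_right {l m k : Type*} [Fintype m] (A : Matrix l m ℂ)
    (B : Matrix m k ℂ) (b : l) (y : k) (x₀ : m) (Q : Prop) [Decidable Q]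
    [∀ x, Decidable (x₀ = x ∧ Q)] (hB : ∀ x, B x y = if x₀ = x ∧ Q then 1 else 0) :
    (A * B) b y = A b x₀ * if Q then 1 else 0 := by
  rw [Matrix.mul_apply, Finset.sum_eq_single x₀]
  · simp [hB]
  · intro x _ hx
    rw [hB, if_neg fun h => hx h.1.symm, mul_zero]
  · exact fun h => absurd (Finset.mem_univ _) h

/-! ### The DRPP as a sum over the results of its `Z`-measurements -/

section Protocol

variable {V : Type} [Fintype V] [DecidableEq V] (G : SimpleGraph V) [DecidableRel G.Adj] {n : ℕ}

/-- The local operator of the whole protocol when each two-party protocol accepts a single run. -/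
def drppKraus (L : ∀ v, {j // Incident G v j} → Matrix (ZMod 2) (Fin n → ZMod 2) ℂ)
    (o : ∀ v, {j // ¬ Incident G v j} → Fin n → ZMod 2) (v : V) :
    Matrix (ZMod 2) (G.edgeSet × Fin n → ZMod 2) ℂ :=
  Matrix.of fun b X => ((1 / √2 : ℝ) : ℂ) *
    ((∏ j : {j // Incident G v j}, L v j b fun i => X (j.1, i)) *
      ((∏ j : {j // Incident G v j}, ∏ i : Fin n, bitSign (X (j.1, i) * ∑ w : V,
        if h : G.Adj v w ∧ ¬ Incident G w j.1 then o w ⟨j.1, h.2⟩ i else 0)) *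
      if (fun (j : {j // ¬ Incident G v j}) i => X (j.1, i)) = o v then 1 else 0))

/-- The outer rounds have indicator kernels and the correction is diagonal, so the product of the
four operators needs no summation. -/
theorem kraus_mul_eq_drppKraus
    (S : ∀ j : G.edgeSet, LocalRound (Copies {v // Incident G v j} (Fin n))
      (Qubits {v // Incident G v j}))
    (o : ∀ j v, (S j).Outcome v) (q : ∀ v, {j // ¬ Incident G v j} → Fin n → ZMod 2) (v : V) :
    (rebuildRound G).kraus v (fun _ => 0) *
        (parRound (Incident G) S).kraus v (fun j => o j.1 ⟨v, j.2⟩) *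
        (correctRound G n q).kraus v () * (divideRound G n).kraus v (q v) =
      drppKraus G (fun v j => (S j.1).kraus ⟨v, j.2⟩ (o j.1 ⟨v, j.2⟩)) q v := by
  ext b X
  have hR : ∀ x : {j // Incident G v j} → ZMod 2, (rebuildRound G).kraus v (fun _ => 0) b x =
      if x = fun _ => 0 + b then ((1 / √2 : ℝ) : ℂ) else 0 := by
    intro x
    simp only [rebuildRound, Matrix.of_apply]
  have hD : ∀ x : {j // Incident G v j} → Fin n → ZMod 2, (divideRound G n).kraus v (q v) x X =
      if (fun (j : {j // Incident G v j}) i => X (j.1, i)) = x ∧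
        (fun (j : {j // ¬ Incident G v j}) i => X (j.1, i)) = q v then 1 else 0 := by
    intro x
    simp only [divideRound, Matrix.of_apply]
  refine (mul_apply_of_indicator_right _ _ b X _ _ hD).trans ?_
  have hC : ∀ A : Matrix (ZMod 2) ({j // Incident G v j} → Fin n → ZMod 2) ℂ,
      ∀ x : {j // Incident G v j} → Fin n → ZMod 2, (A * (correctRound G n q).kraus v ()) b x =
        A b x * ∏ j : {j // Incident G v j}, ∏ i : Fin n, bitSign (x j i * ∑ w : V,
          if h : G.Adj v w ∧ ¬ Incident G w j.1 then q w ⟨j.1, h.2⟩ i else 0) := by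
    intro A x
    exact Matrix.mul_diagonal _ _ _ _
  refine (congrArg (· * _) ((hC _ _).trans
    (congrArg (· * _) (mul_apply_of_indicator_left _ _ b _ _ hR _)))).trans ?_
  simp only [drppKraus, parRound, Matrix.of_apply, zero_add, mul_assoc]

/-- The results `q` of the dividing measurements are all kept, hence the sum; every later round has
a single contributing outcome. -/
theorem apply_DRPP
    (S : ∀ j : G.edgeSet, LocalRound (Copies {v // Incident G v j} (Fin n))
      (Qubits {v // Incident G v j}))
    (accS : ∀ j, (∀ v, (S j).Outcome v) → Bool) (o : ∀ j v, (S j).Outcome v)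
    (ho : ∀ j o', accS j o' = true ↔ o' = o j)
    (ρ : Matrix (∀ v, Copies V (G.edgeSet × Fin n) v) (∀ v, Copies V (G.edgeSet × Fin n) v) ℂ) :
    (DRPP G fun j => SLOCC.last (S j) (accS j)).apply ρ =
      ∑ q : ∀ v, {j // ¬ Incident G v j} → Fin n → ZMod 2,
        tensorOp (drppKraus G (fun v j => (S j.1).kraus ⟨v, j.2⟩ (o j.1 ⟨v, j.2⟩)) q) * ρ *
          (tensorOp (drppKraus G (fun v j => (S j.1).kraus ⟨v, j.2⟩ (o j.1 ⟨v, j.2⟩)) q))ᴴ := by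
  refine (SLOCC.apply_step _ _ _ _ ρ).trans (Finset.sum_congr rfl fun q _ => ?_)
  refine (SLOCC.apply_step _ _ _ _ _).trans ?_
  refine (Fintype.sum_eq_single (fun _ => ()) fun x hx => absurd rfl hx).trans ?_
  refine (apply_parThen_zero (Incident G) (rebuildRound G) _ (fun _ _ => 0) ?_ S accS o ho
    _).trans ?_
  · intro (t' : ∀ v, {j // Incident G v j} → ZMod 2)
    exact decide_eq_true_iff.trans
      ⟨fun h => funext fun v => funext fun j => h v j, fun h v j => by rw [h]⟩
  · rw [conj_conj, conj_conj, tensorOp_mul, tensorOp_mul]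
    exact congrArg (fun K => tensorOp K * ρ * (tensorOp K)ᴴ)
      (funext fun v => kraus_mul_eq_drppKraus G S o q v)

end Protocol

/-! ### The output of the Divide and Rebuild Purification Protocol -/

section Output

variable {V : Type} [Fintype V] [DecidableEq V] (G : SimpleGraph V) [DecidableRel G.Adj] {n : ℕ}

/-- The factor of the local operator of party `v` that belongs to the edge `j`, without
corrections. -/
def edgeFactor (L : ∀ v, {j // Incident G v j} → Matrix (ZMod 2) (Fin n → ZMod 2) ℂ)
    (q : ∀ v, {j // ¬ Incident G v j} → Fin n → ZMod 2) (v : V) (j : G.edgeSet) (b : ZMod 2)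
    (ξ : Fin n → ZMod 2) : ℂ :=
  if h : Incident G v j then L v ⟨j, h⟩ b ξ else if ξ = q v ⟨j, h⟩ then 1 else 0

/-- The correction which party `v` applies to the `i`-th copy for the edge `j`. -/
def correction (q : ∀ v, {j // ¬ Incident G v j} → Fin n → ZMod 2) (v : V) (j : G.edgeSet)
    (i : Fin n) : ZMod 2 :=
  ∑ w : V, if h : G.Adj v w ∧ ¬ Incident G w j then q w ⟨j, h.2⟩ i else 0

theorem drppKraus_apply (L : ∀ v, {j // Incident G v j} → Matrix (ZMod 2) (Fin n → ZMod 2) ℂ)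
    (q : ∀ v, {j // ¬ Incident G v j} → Fin n → ZMod 2) (v : V) (b : ZMod 2)
    (X : G.edgeSet × Fin n → ZMod 2) :
    drppKraus G L q v b X =
      (((1 / √2 : ℝ) : ℂ) * ∏ j, edgeFactor G L q v j b fun i => X (j, i)) *
        ∏ j, ∏ i, if Incident G v j then bitSign (X (j, i) * correction G q v j i) else 1 := by
  have h1 : ∏ j, edgeFactor G L q v j b (fun i => X (j, i)) =
      (∏ j : {j // Incident G v j}, L v j b fun i => X (j.1, i)) *
        if (fun (j : {j // ¬ Incident G v j}) i => X (j.1, i)) = q v then 1 else 0 := by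
    unfold edgeFactor
    rw [Fintype.prod_dite]
    congr 1
    rw [Finset.prod_ite_zero]
    simp [funext_iff]
  have h2 : (∏ j, ∏ i, if Incident G v j then bitSign (X (j, i) * correction G q v j i) else 1) =
      ∏ j : {j // Incident G v j}, ∏ i : Fin n, bitSign (X (j.1, i) * correction G q v j.1 i) := by
    have : ∀ j : G.edgeSet, (∏ i, if Incident G v j then
        bitSign (X (j, i) * correction G q v j i) else 1) =
        if Incident G v j then ∏ i, bitSign (X (j, i) * correction G q v j i) else 1 := by
      intro j; split <;> simp
    simp only [this]
    rw [← Finset.prod_filter]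
    exact Finset.prod_subtype _ (by simp) _
  rw [h1, h2]
  simp only [drppKraus, Matrix.of_apply, correction]
  ring

/-- The sign left behind by the measured qubits. -/
def measuredSign (q : ∀ v, {j // ¬ Incident G v j} → Fin n → ZMod 2) : ℂ :=
  ∏ j : G.edgeSet, ∏ i, graphSign G fun w => if h : Incident G w j then 0 else q w ⟨j, h⟩ i

theorem measuredSign_mul_self (q : ∀ v, {j // ¬ Incident G v j} → Fin n → ZMod 2) :
    measuredSign G q * measuredSign G q = 1 := by
  simp [measuredSign, ← Finset.prod_mul_distrib, graphSign_mul_self]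

theorem star_measuredSign (q : ∀ v, {j // ¬ Incident G v j} → Fin n → ZMod 2) :
    star (measuredSign G q) = measuredSign G q := by
  simp only [measuredSign, star_prod, star_graphSign]

theorem prod_edgeSign (x : V → ZMod 2) : ∏ j : G.edgeSet, edgeSign j.1 x = graphSign G x := by
  unfold graphSign
  exact (Finset.prod_subtype _ (fun e => SimpleGraph.mem_edgeFinset) fun e => edgeSign e x).symm

/-- Nonvanishing of the two operators places the configurations at the ends in the cosets, where the
`n` signs reduce to one. -/
theorem CodePair.prod_edgeSign_of_ne_zero {V : Type} [DecidableEq V] (G : SimpleGraph V)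
    (c : CodePair n) {e : Sym2 V} (he : e ∈ G.edgeSet) (x : V → ZMod 2) (Ξ : V → Fin n → ZMod 2)
    (h : ∀ v ∈ e, c.kraus (role e v) (x v) (Ξ v) ≠ 0) :
    ∏ i, edgeSign e (fun v => Ξ v i) = edgeSign e x := by
  induction e using Sym2.ind with
  | _ a b =>
    rw [SimpleGraph.mem_edgeSet] at he
    simp only [edgeSign_mk, ← bitSign_sum]
    have ha := h a (by simp)
    have hb := h b (by simp)
    rw [role_mk he.ne] at hb
    have := c.kraus_mul_kraus_mul_bitSign (role s(a, b) a) (x a) (x b) (Ξ a) (Ξ b)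
    exact mul_left_cancel₀ (mul_ne_zero ha hb) this

/-- All phases become the sign of the target graph state, up to a sign depending only on `q`: the
corrections isolate the gates along each edge, and the codes merge their `n` copies into one. This
is the hypothesis of `conj_tensorOp_of_support`. -/
theorem drppKraus_mul_graphState (c : CodePair n) (k : ∀ j : G.edgeSet, {v // Incident G v j} → ℝ)
    (q : ∀ v, {j // ¬ Incident G v j} → Fin n → ZMod 2) (x : V → ZMod 2)
    (X : V → G.edgeSet × Fin n → ZMod 2) :
    let L := fun v (j : {j // Incident G v j}) => (k j.1 ⟨v, j.2⟩ : ℂ) • c.kraus (role j.1.1 v)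
    (∏ v, drppKraus G L q v (x v) (X v)) * ∏ z, graphState G (fun v => X v z) =
      (((1 / √2 : ℝ) : ℂ) ^ (Fintype.card V * Fintype.card (G.edgeSet × Fin n)) * measuredSign G q *
        graphSign G x) *
        ∏ v, (((1 / √2 : ℝ) : ℂ) * ∏ j, edgeFactor G L q v j (x v) fun i => X v (j, i)) := by
  intro L
  simp only [drppKraus_apply, Finset.prod_mul_distrib (f := fun v => _ * _)]
  -- Only the support matters. Nonvanishing means that the qubits at the ends lie in their cosets
  -- and the measured ones agree with `q`.
  by_cases h0 : ∏ v, (((1 / √2 : ℝ) : ℂ) * ∏ j, edgeFactor G L q v j (x v) fun i => X v (j, i)) = 0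
  · rw [h0]; ring
  have hne : ∀ v j, edgeFactor G L q v j (x v) (fun i => X v (j, i)) ≠ 0 := by
    intro v j
    have h1 := Finset.prod_ne_zero_iff.1 h0 v (Finset.mem_univ v)
    exact Finset.prod_ne_zero_iff.1 (right_ne_zero_of_mul h1) j (Finset.mem_univ j)
  have hin : ∀ (j : G.edgeSet), ∀ v ∈ j.1,
      c.kraus (role j.1 v) (x v) (fun i => X v (j, i)) ≠ 0 := by
    intro j v hv
    have := hne v j
    rw [edgeFactor, dif_pos hv] at this
    exact right_ne_zero_of_mul this
  have hout : ∀ (j : G.edgeSet) v (hv : ¬ Incident G v j), ∀ i, X v (j, i) = q v ⟨j, hv⟩ i := by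
    intro j v hv i
    have := hne v j
    rw [edgeFactor, dif_neg hv] at this
    exact congrFun (by_contra fun hc => this (if_neg hc)) i
  have hz : ∀ (j : G.edgeSet) (i : Fin n), graphSign G (fun v => X v (j, i)) *
      (∏ v, if Incident G v j then bitSign (X v (j, i) * correction G q v j i) else 1) =
      edgeSign j.1 (fun v => X v (j, i)) *
        graphSign G fun w => if h : Incident G w j then 0 else q w ⟨j, h⟩ i := by
    intro j i
    have h1 := graphSign_mul_correction G (SimpleGraph.mem_edgeFinset.2 j.2) fun v => X v (j, i)
    have h2 : ∀ v, (∑ w, if G.Adj v w ∧ w ∉ j.1 then X w (j, i) else 0) = correction G q v j i := by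
      intro v
      refine Finset.sum_congr rfl fun w _ => ?_
      by_cases h : G.Adj v w ∧ ¬ Incident G w j
      · rw [dif_pos h, if_pos h, hout j w h.2]
      · rw [dif_neg h, if_neg h]
    have h3 : (fun w => if w ∈ j.1 then 0 else X w (j, i)) =
        fun w => if h : Incident G w j then 0 else q w ⟨j, h⟩ i := by
      funext w
      by_cases h : Incident G w j
      · rw [if_pos h, dif_pos h]
      · rw [if_neg h, dif_neg h, hout j w h]
    simp only [h2] at h1
    rw [h3] at h1
    exact h1
  have hsign : (∏ v, ∏ j : G.edgeSet, ∏ i,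
      if Incident G v j then bitSign (X v (j, i) * correction G q v j i) else 1) *
      ∏ z : G.edgeSet × Fin n, graphSign G (fun v => X v z) =
      measuredSign G q * graphSign G x := by
    rw [Finset.prod_comm, Fintype.prod_prod_type, ← Finset.prod_mul_distrib, ← prod_edgeSign,
      measuredSign, ← Finset.prod_mul_distrib]
    refine Finset.prod_congr rfl fun j _ => ?_
    rw [Finset.prod_comm, ← Finset.prod_mul_distrib,
      ← c.prod_edgeSign_of_ne_zero G j.2 x (fun v i => X v (j, i)) (hin j),
      ← Finset.prod_mul_distrib]
    refine Finset.prod_congr rfl fun i _ => ?_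
    rw [mul_comm, hz, mul_comm]
  simp only [graphState_eq]
  rw [Finset.prod_mul_distrib (s := (Finset.univ : Finset (G.edgeSet × Fin n))), Finset.prod_const,
    Finset.card_univ, ← pow_mul]
  linear_combination ((∏ v, (((1 / √2 : ℝ) : ℂ) * ∏ j, edgeFactor G L q v j (x v)
    fun i => X v (j, i))) *
    ((1 / √2 : ℝ) : ℂ) ^ (Fintype.card V * Fintype.card (G.edgeSet × Fin n))) * hsign

theorem sum_sum_prod_curry {J : Type} [Fintype J] [DecidableEq J]
    (f : J → (Fin n → ZMod 2) → (Fin n → ZMod 2) → ℂ) :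
    ∑ X : J × Fin n → ZMod 2, ∑ Y : J × Fin n → ZMod 2,
      ∏ j, f j (fun i => X (j, i)) (fun i => Y (j, i)) = ∏ j, ∑ ξ, ∑ η, f j ξ η := by
  have h : ∀ g : (J → Fin n → ZMod 2) → ℂ,
      ∑ X : J × Fin n → ZMod 2, g (fun j i => X (j, i)) = ∑ ξ, g ξ := fun g =>
    Equiv.sum_comp (Equiv.curry J (Fin n) (ZMod 2)) g
  have h1 : ∀ ξ : J → Fin n → ZMod 2, ∑ Y : J × Fin n → ZMod 2,
      ∏ j, f j (ξ j) (fun i => Y (j, i)) = ∏ j, ∑ η, f j (ξ j) η := fun ξ => by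
    rw [h fun η => ∏ j, f j (ξ j) (η j), Fintype.prod_sum]
  simp only [h1 fun j i => _]
  rw [h fun ξ => ∏ j, ∑ η, f j (ξ j) η, Fintype.prod_sum]

/-- The factors of a party belong to different edges and decouple. The dampings of its edges
multiply because the rebuilding projection gives all its qubits the same value. -/
theorem sum_edgeFactor (c : CodePair n) (k : ∀ j : G.edgeSet, {v // Incident G v j} → ℝ)
    (q : ∀ v, {j // ¬ Incident G v j} → Fin n → ZMod 2) {p : ℝ} (h0 : 0 ≤ p) (h1 : p < 1) (v : V)
    (b b' : ZMod 2) :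
    let L := fun v (j : {j // Incident G v j}) => (k j.1 ⟨v, j.2⟩ : ℂ) • c.kraus (role j.1.1 v)
    ∑ X : G.edgeSet × Fin n → ZMod 2, ∑ Y : G.edgeSet × Fin n → ZMod 2,
      (((1 / √2 : ℝ) : ℂ) * ∏ j, edgeFactor G L q v j b fun i => X (j, i)) *
        (∏ z, damping (1 - 2 * p) (X z + Y z)) *
        star (((1 / √2 : ℝ) : ℂ) * ∏ j, edgeFactor G L q v j b' fun i => Y (j, i)) =
      ((1 / 2 * ∏ j : {j // Incident G v j},
        (k j.1 ⟨v, j.2⟩ ^ 2 * c.weight p (role j.1.1 v)) : ℝ) : ℂ) *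
        damping (∏ j : {j // Incident G v j}, c.damp p (role j.1.1 v)) (b + b') := by
  intro L
  have hs : star ((1 / √2 : ℝ) : ℂ) = ((1 / √2 : ℝ) : ℂ) := Complex.conj_ofReal _
  have hterm : ∀ X Y : G.edgeSet × Fin n → ZMod 2,
      (((1 / √2 : ℝ) : ℂ) * ∏ j, edgeFactor G L q v j b fun i => X (j, i)) *
        (∏ z, damping (1 - 2 * p) (X z + Y z)) *
        star (((1 / √2 : ℝ) : ℂ) * ∏ j, edgeFactor G L q v j b' fun i => Y (j, i)) =
      1 / 2 * ∏ j, edgeFactor G L q v j b (fun i => X (j, i)) *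
        (∏ i, damping (1 - 2 * p) (X (j, i) + Y (j, i))) *
        star (edgeFactor G L q v j b' fun i => Y (j, i)) := by
    intro X Y
    rw [Fintype.prod_prod_type, star_mul', star_prod, Finset.prod_mul_distrib,
      Finset.prod_mul_distrib, ← inv_sqrt_two_mul_self, hs]
    ring
  simp only [hterm, ← Finset.mul_sum]
  rw [sum_sum_prod_curry fun j ξ η => edgeFactor G L q v j b ξ *
    (∏ i, damping (1 - 2 * p) (ξ i + η i)) * star (edgeFactor G L q v j b' η)]
  have hj : ∀ j : G.edgeSet, ∑ ξ, ∑ η, edgeFactor G L q v j b ξ *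
      (∏ i, damping (1 - 2 * p) (ξ i + η i)) * star (edgeFactor G L q v j b' η) =
      if h : Incident G v j then ((k j ⟨v, h⟩ ^ 2 * c.weight p (role j.1 v) : ℝ) : ℂ) *
        damping (c.damp p (role j.1 v)) (b + b') else 1 := by
    intro j
    by_cases h : Incident G v j
    · simp only [edgeFactor, dif_pos h]
      rw [Complex.ofReal_mul, mul_assoc, ← c.sum_kraus_damping h0 h1, Finset.mul_sum]
      refine Finset.sum_congr rfl fun X _ => ?_
      rw [Finset.mul_sum]
      refine Finset.sum_congr rfl fun Y _ => ?_
      simp only [L, Matrix.smul_apply, smul_eq_mul, star_mul', Complex.star_def,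
        Complex.conj_ofReal]
      push_cast
      ring
    -- A qubit measured in the `Z`-basis has equal row and column values, where the noise has no
    -- effect.
    · simp only [edgeFactor, dif_neg h]
      simp [damping, CharTwo.add_self_eq_zero, apply_ite, ite_mul]
  simp only [hj]
  rw [Fintype.prod_dite, Finset.prod_const_one, mul_one, Finset.prod_mul_distrib, damping_prod]
  push_cast
  ring

/-- The weight of the output of the protocol for one result of the measurements. -/
def drppWeight (c : CodePair n) (k : ∀ j : G.edgeSet, {v // Incident G v j} → ℝ) (p : ℝ) : ℝ :=
  (1 / 2) ^ (Fintype.card V * Fintype.card (G.edgeSet × Fin n)) * 2 ^ Fintype.card V *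
    ∏ v, (1 / 2 * ∏ j : {j // Incident G v j}, (k j.1 ⟨v, j.2⟩ ^ 2 * c.weight p (role j.1.1 v)))

/-- Neither weight nor output state depends on the results `q`, since `measuredSign` cancels against
its conjugate. No post-selection on these results is needed. -/
theorem conj_drppKraus (c : CodePair n) (k : ∀ j : G.edgeSet, {v // Incident G v j} → ℝ)
    (q : ∀ v, {j // ¬ Incident G v j} → Fin n → ZMod 2) {p : ℝ} (h0 : 0 ≤ p) (h1 : p < 1) :
    let L := fun v (j : {j // Incident G v j}) => (k j.1 ⟨v, j.2⟩ : ℂ) • c.kraus (role j.1.1 v)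
    tensorOp (drppKraus G L q) * copies (G.edgeSet × Fin n) (noisyGraphState G p) *
        (tensorOp (drppKraus G L q))ᴴ =
      (drppWeight G c k p : ℂ) • dephased G fun v =>
        ∏ j : {j // Incident G v j}, c.damp p (role j.1.1 v) := by
  intro L
  ext x y
  rw [copies_noisyGraphState]
  refine (conj_tensorOp_of_support (d := Copies V (G.edgeSet × Fin n)) (m := Qubits V)
    (drppKraus G L q)
    (fun v => Matrix.of fun b X =>
      ((1 / √2 : ℝ) : ℂ) * ∏ j, edgeFactor G L q v j b fun i => X (j, i))
    (fun X => ∏ z, graphState G fun v => X v z)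
    (fun x => ((1 / √2 : ℝ) : ℂ) ^ (Fintype.card V * Fintype.card (G.edgeSet × Fin n)) *
      measuredSign G q * graphSign G x)
    (fun _ X Y => ∏ z, damping (1 - 2 * p) (X z + Y z))
    (fun x X => drppKraus_mul_graphState G c k q x X) x y).trans ?_
  simp only [Matrix.of_apply]
  rw [Finset.prod_congr rfl fun v _ => sum_edgeFactor G c k q h0 h1 v (x v) (y v),
    Finset.prod_mul_distrib, Matrix.smul_apply, dephased, Matrix.of_apply, graphState_mul]
  have hs : star ((1 / √2 : ℝ) : ℂ) = ((1 / √2 : ℝ) : ℂ) := Complex.conj_ofReal _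
  simp only [star_mul', star_pow, hs, star_measuredSign, star_graphSign, smul_eq_mul, drppWeight]
  rw [Complex.ofReal_mul, Complex.ofReal_mul, ← Complex.ofReal_prod]
  have h2 : (((1 / 2 : ℝ) ^ (Fintype.card V * Fintype.card (G.edgeSet × Fin n)) : ℝ) : ℂ) =
      ((1 / √2 : ℝ) : ℂ) ^ (Fintype.card V * Fintype.card (G.edgeSet × Fin n)) *
      ((1 / √2 : ℝ) : ℂ) ^ (Fintype.card V * Fintype.card (G.edgeSet × Fin n)) := by
    rw [← mul_pow, inv_sqrt_two_mul_self]; push_cast; rfl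
  -- The factor `2 ^ Fintype.card V` in `drppWeight` compensates the normalisation of the target
  -- graph state.
  have h3 : (((2 : ℝ) ^ Fintype.card V : ℝ) : ℂ) * (1 / 2) ^ Fintype.card V = 1 := by
    push_cast
    rw [← mul_pow]; norm_num
  rw [h2]
  set κ := ((1 / √2 : ℝ) : ℂ) ^ (Fintype.card V * Fintype.card (G.edgeSet × Fin n))
  set w := ((∏ v, (1 / 2 * ∏ j : {j // Incident G v j},
    (k j.1 ⟨v, j.2⟩ ^ 2 * c.weight p (role j.1.1 v))) : ℝ) : ℂ)
  have h4 := measuredSign_mul_self G q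
  linear_combination (κ * κ * graphSign G x * graphSign G y * w *
    ∏ v, damping (∏ j : {j // Incident G v j}, c.damp p (role j.1.1 v)) (x v + y v)) * (h4 - h3)

theorem drppWeight_pos (c : CodePair n) (k : ∀ j : G.edgeSet, {v // Incident G v j} → ℝ)
    (hk : ∀ j v, 0 < k j v) {p : ℝ} (h0 : 0 ≤ p) (h1 : p < 1) : 0 < drppWeight G c k p := by
  have h2 : ∀ v, 0 < ∏ j : {j // Incident G v j},
      (k j.1 ⟨v, j.2⟩ ^ 2 * c.weight p (role j.1.1 v)) := fun v =>
    Finset.prod_pos fun j _ => mul_pos (pow_pos (hk _ _) 2) (c.weight_pos h0 h1 _)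
  have h3 : 0 < ∏ v, (1 / 2 * ∏ j : {j // Incident G v j},
      (k j.1 ⟨v, j.2⟩ ^ 2 * c.weight p (role j.1.1 v))) :=
    Finset.prod_pos fun v _ => mul_pos (by norm_num) (h2 v)
  unfold drppWeight
  positivity

end Output

/-! ### Fidelities reached by the DRPP -/

section Purification

variable {V : Type} [Fintype V] [DecidableEq V] (G : SimpleGraph V) [DecidableRel G.Adj]

theorem DRPPPurifies.purifiable {p : ℝ} (h : DRPPPurifies G p) : Purifiable G p := by
  intro ε hε
  obtain ⟨n, r, B, -, hB⟩ := h ε hε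
  exact ⟨G.edgeSet × Fin n, inferInstance, inferInstance, _, DRPP G B, hB⟩

theorem one_sub_mul_le_pow {δ : ℝ} (hδ : δ ≤ 1) (k : ℕ) : 1 - k * δ ≤ (1 - δ) ^ k := by
  have := one_add_mul_le_pow (a := -δ) (by linarith) k
  simpa [sub_eq_add_neg] using this

theorem exists_ends {V : Type} [DecidableEq V] (G : SimpleGraph V) (j : G.edgeSet) :
    ∃ a b : {v // Incident G v j}, a ≠ b ∧ (∀ v, v = a ∨ v = b) ∧ role j.1 b.1 = !role j.1 a.1 := by
  obtain ⟨e, he⟩ := j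
  induction e using Sym2.ind with
  | _ a b =>
    have hab : a ≠ b := G.ne_of_adj he
    refine ⟨⟨a, Sym2.mem_mk_left a b⟩, ⟨b, Sym2.mem_mk_right a b⟩, by simpa using hab, ?_,
      role_mk hab⟩
    rintro ⟨v, hv⟩
    simpa using Sym2.mem_iff.1 hv

theorem card_ends {V : Type} [Fintype V] [DecidableEq V] (G : SimpleGraph V) (j : G.edgeSet) :
    Fintype.card {v // Incident G v j} = 2 := by
  obtain ⟨a, b, hab, hU, -⟩ := exists_ends G j
  have huniv : (Finset.univ : Finset {v // Incident G v j}) = {a, b} := by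
    ext v; simpa using hU v
  rw [← Finset.card_univ, huniv, Finset.card_pair hab]

theorem exists_conj_copies_ends {V : Type} [Fintype V] [DecidableEq V] (G : SimpleGraph V) {n : ℕ}
    (c : CodePair n) (j : G.edgeSet) (k : {v // Incident G v j} → ℝ) (hk : ∀ v, 0 < k v)
    {p : ℝ} (h0 : 0 ≤ p) (h1 : p < 1) :
    ∃ w : ℝ, 0 < w ∧ tensorOp (fun v => (k v : ℂ) • c.kraus (role j.1 v.1)) *
        copies (Fin n) (noisyGraphState (⊤ : SimpleGraph {v // Incident G v j}) p) *
        (tensorOp fun v => (k v : ℂ) • c.kraus (role j.1 v.1))ᴴ =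
      (w : ℂ) • dephased (⊤ : SimpleGraph {v // Incident G v j}) fun v =>
        c.damp p (role j.1 v.1) := by
  obtain ⟨a, b, hab, hU, hr⟩ := exists_ends G j
  have hconj := conj_copies_two_party c (fun v : {v // Incident G v j} => role j.1 v.1) hab hU hr k
    h0 h1
  refine ⟨_, ?_, hconj⟩
  have : 0 < ∏ v, k v ^ 2 * c.weight p (role j.1 v.1) :=
    Finset.prod_pos fun v _ => mul_pos (pow_pos (hk v) 2) (c.weight_pos h0 h1 _)
  positivity

open Classical in
/-- The acceptance rule that accepts a single outcome. -/
def acceptOnly {O : Type*} (o o' : O) : Bool := decide (o' = o)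

theorem acceptOnly_iff {O : Type*} (o o' : O) : acceptOnly o o' = true ↔ o' = o := by
  simp [acceptOnly]

/-- Above the threshold the Divide and Rebuild Purification Protocol purifies the noisy state. -/
theorem drppPurifies_of_half_lt {p : ℝ} (h0 : 0 ≤ p) (h1 : p < 1) (h : 1 / 2 < (1 - p) ^ 2) :
    DRPPPurifies G p := by
  intro ε hε
  set M := Fintype.card G.edgeSet
  set N := Fintype.card V
  -- The denominator covers both requirements: `2δ ≤ ε` for a pair and `MNδ ≤ ε` for the whole
  -- graph. The cap at `1` permits Bernoulli's inequality.
  set δ : ℝ := min 1 (ε / ((M * N : ℕ) + 2)) with hδdef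
  have hδ0 : 0 < δ := lt_min one_pos (by positivity)
  have hδ1 : δ ≤ 1 := min_le_left _ _
  have hδε : ((M * N : ℕ) + 2) * δ ≤ ε := by
    have := min_le_right (1 : ℝ) (ε / ((M * N : ℕ) + 2))
    rw [← hδdef, le_div_iff₀ (by positivity)] at this
    linarith
  obtain ⟨n, c, hc⟩ := exists_codePair h0 h1 h hδ0
  choose S o k hk hS using fun j : G.edgeSet => exists_localRound
    (d := Copies {v // Incident G v j} (Fin n)) (e := Qubits {v // Incident G v j})
    fun v => c.kraus (role j.1 v.1)
  have hMN : (0 : ℝ) ≤ (M * N : ℕ) * δ := by positivity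
  refine ⟨n, 0, fun j => SLOCC.last (S j) (acceptOnly (o j)), fun j => ?_, ?_⟩
  · obtain ⟨w, hw, hconj⟩ := exists_conj_copies_ends G c j (k j) (hk j) h0 h1
    have hout : (SLOCC.last (S j) (acceptOnly (o j))).apply
        (copies (Fin n) (noisyGraphState (⊤ : SimpleGraph {v // Incident G v j}) p)) =
        (w : ℂ) • dephased (⊤ : SimpleGraph {v // Incident G v j}) fun v =>
          c.damp p (role j.1 v.1) := by
      rw [SLOCC.apply_last_of_accept_iff _ _ (o j) (acceptOnly_iff (o j)), funext (hS j), hconj]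
    refine ⟨by rw [hout, trace_smul_dephased]; exact hw, ?_⟩
    rw [hout, fidelity_smul_dephased _ hw]
    calc 1 - ε ≤ 1 - (2 : ℕ) * δ := by push_cast; linarith
      _ ≤ (1 - δ) ^ 2 := one_sub_mul_le_pow hδ1 2
      _ = ∏ _v : {v // Incident G v j}, (1 - δ) := by
        rw [Finset.prod_const, Finset.card_univ, card_ends]
      _ ≤ _ := Finset.prod_le_prod (fun v _ => by linarith) fun v _ => by
        have := hc (role j.1 v.1); linarith
  · set Q : V → ℝ := fun v => ∏ j : {j // Incident G v j}, c.damp p (role j.1.1 v) with hQ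
    -- All measurement results give the same weight, so their number enters as a factor.
    set w : ℝ := Fintype.card (∀ v, {j : G.edgeSet // ¬ Incident G v j} → Fin n → ZMod 2) *
      drppWeight G c k p with hw
    have hout : (DRPP G fun j => SLOCC.last (S j) (acceptOnly (o j))).apply
        (copies (G.edgeSet × Fin n) (noisyGraphState G p)) = (w : ℂ) • dephased G Q := by
      rw [apply_DRPP G S (fun j => acceptOnly (o j)) o fun j => acceptOnly_iff (o j)]
      have hL : (fun v (j : {j // Incident G v j}) => (S j.1).kraus ⟨v, j.2⟩ (o j.1 ⟨v, j.2⟩)) =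
          fun v (j : {j // Incident G v j}) =>
            (k j.1 ⟨v, j.2⟩ : ℂ) • c.kraus (role j.1.1 v) := by
        funext v j
        exact hS j.1 ⟨v, j.2⟩
      rw [hL, Finset.sum_congr rfl fun q _ => conj_drppKraus G c k q h0 h1, Finset.sum_const,
        Finset.card_univ, hw, Complex.ofReal_mul, mul_smul,
        Complex.ofReal_natCast, Nat.cast_smul_eq_nsmul]
    have hpos : 0 < w := by
      have := drppWeight_pos G c k hk h0 h1
      have h2 : 0 < Fintype.card (∀ v, {j : G.edgeSet // ¬ Incident G v j} → Fin n → ZMod 2) :=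
        Fintype.card_pos
      positivity
    refine ⟨by rw [hout, trace_smul_dephased]; exact hpos, ?_⟩
    rw [hout, fidelity_smul_dephased _ hpos]
    have hle : ∀ v, (1 - δ) ^ M ≤ Q v := by
      intro v
      calc (1 - δ) ^ M ≤ (1 - δ) ^ Fintype.card {j // Incident G v j} :=
            pow_le_pow_of_le_one (by linarith) (by linarith) (Fintype.card_subtype_le _)
        _ = ∏ _j : {j // Incident G v j}, (1 - δ) := by rw [Finset.prod_const, Finset.card_univ]
        _ ≤ _ := Finset.prod_le_prod (fun v _ => by linarith) fun j _ => hc _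
    have hM0 : 0 ≤ (1 - δ) ^ M := pow_nonneg (by linarith) M
    have hM1 : (1 - δ) ^ M ≤ 1 := pow_le_one₀ (by linarith) (by linarith)
    -- At most `M` edges meet at a vertex, and `(1 + Q v) / 2` is at least `(1 - δ)^M` because that
    -- power bounds `Q v` from below and does not exceed one.
    calc 1 - ε ≤ 1 - (M * N : ℕ) * δ := by linarith
      _ ≤ (1 - δ) ^ (M * N) := one_sub_mul_le_pow hδ1 _
      _ = ∏ _v : V, (1 - δ) ^ M := by rw [Finset.prod_const, Finset.card_univ, pow_mul]
      _ ≤ _ := Finset.prod_le_prod (fun v _ => hM0) fun v _ => by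
        have := hle v; linarith

end Purification

/-! ### Threshold values -/

section Threshold

variable {Q : ℝ → Prop}

theorem inv_sqrt_two_sq : (1 / √2 : ℝ) ^ 2 = 1 / 2 := by
  rw [div_pow, Real.sq_sqrt (by norm_num)]; norm_num

theorem half_lt_inv_sqrt_two : (1 / 2 : ℝ) < 1 / √2 := by
  have h : (0 : ℝ) < 1 / √2 := by positivity
  nlinarith [inv_sqrt_two_sq]

theorem inv_sqrt_two_lt_one : (1 / √2 : ℝ) < 1 := by
  have h : (0 : ℝ) < 1 / √2 := by positivity
  nlinarith [inv_sqrt_two_sq]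

theorem inv_sqrt_two_le_of_property
    (hneg : ∀ p ∈ Set.Icc (0 : ℝ) (1 / 2), (1 - p) ^ 2 < 1 / 2 → ¬ Q p) {p : ℝ}
    (hp : p ∈ Set.Icc (0 : ℝ) (1 / 2)) (hQ : Q p) :
    1 / √2 ≤ 1 - p := by
  by_contra! hlt
  refine hneg p hp ?_ hQ
  rw [← inv_sqrt_two_sq]
  exact pow_lt_pow_left₀ hlt (by linarith [hp.2]) two_ne_zero

theorem property_of_lt
    (hpos : ∀ p ∈ Set.Icc (0 : ℝ) (1 / 2), 1 / 2 < (1 - p) ^ 2 → Q p) {p : ℝ}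
    (h0 : 0 ≤ p) (hp : p < 1 - 1 / √2) : Q p := by
  refine hpos p ⟨h0, by linarith [half_lt_inv_sqrt_two]⟩ ?_
  rw [← inv_sqrt_two_sq]
  exact pow_lt_pow_left₀ (by linarith) (by positivity) two_ne_zero

/-- The hypotheses say nothing at the threshold itself, but a supremum is not affected by one point.
-/
theorem isLUB_threshold
    (hneg : ∀ p ∈ Set.Icc (0 : ℝ) (1 / 2), (1 - p) ^ 2 < 1 / 2 → ¬ Q p)
    (hpos : ∀ p ∈ Set.Icc (0 : ℝ) (1 / 2), 1 / 2 < (1 - p) ^ 2 → Q p) :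
    IsLUB {p | p ∈ Set.Icc (0 : ℝ) (1 / 2) ∧ Q p} (1 - 1 / √2) := by
  constructor
  · rintro p ⟨hp, hQ⟩
    linarith [inv_sqrt_two_le_of_property hneg hp hQ]
  · intro B hB
    have hmem : ∀ p, 0 ≤ p → p < 1 - 1 / √2 → p ≤ B := fun p h0 hp =>
      hB ⟨⟨h0, by linarith [half_lt_inv_sqrt_two]⟩, property_of_lt hpos h0 hp⟩
    by_contra! hlt
    have hB0 := hmem 0 le_rfl (by linarith [inv_sqrt_two_lt_one])
    have := hmem ((B + (1 - 1 / √2)) / 2) (by linarith) (by linarith)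
    linarith

theorem sInf_threshold
    (hneg : ∀ p ∈ Set.Icc (0 : ℝ) (1 / 2), (1 - p) ^ 2 < 1 / 2 → ¬ Q p)
    (hpos : ∀ p ∈ Set.Icc (0 : ℝ) (1 / 2), 1 / 2 < (1 - p) ^ 2 → Q p) (N : ℕ) :
    sInf {f | ∃ p ∈ Set.Icc (0 : ℝ) (1 / 2), Q p ∧ f = (1 - p) ^ N} =
      (2 : ℝ) ^ (-(N : ℝ) / 2) := by
  have hval : (2 : ℝ) ^ (-(N : ℝ) / 2) = (1 / √2) ^ N := by
    rw [Real.sqrt_eq_rpow, one_div, ← Real.rpow_neg (by norm_num), ← Real.rpow_natCast,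
      ← Real.rpow_mul (by norm_num)]
    congr 1
    ring
  have ht := inv_sqrt_two_lt_one
  have hmem : ∀ p, 0 ≤ p → p < 1 - 1 / √2 →
      (1 - p) ^ N ∈ {f | ∃ p ∈ Set.Icc (0 : ℝ) (1 / 2), Q p ∧ f = (1 - p) ^ N} := fun p h0 hp =>
    ⟨p, ⟨h0, by linarith [half_lt_inv_sqrt_two]⟩, property_of_lt hpos h0 hp, rfl⟩
  rw [hval]
  refine IsGLB.csInf_eq ⟨?_, ?_⟩ ⟨_, hmem 0 le_rfl (by linarith)⟩
  · rintro _ ⟨p, hp, hQ, rfl⟩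
    exact pow_le_pow_left₀ (by positivity) (inv_sqrt_two_le_of_property hneg hp hQ) N
  · intro B hB
    -- The infimum need not be shown to be attained: it is the limit of the fidelities as `p`
    -- increases to the threshold.
    have hlim : Filter.Tendsto (fun p : ℝ => (1 - p) ^ N) (nhdsWithin (1 - 1 / √2)
        (Set.Iio (1 - 1 / √2))) (nhds ((1 - (1 - 1 / √2)) ^ N)) :=
      (Continuous.tendsto (by fun_prop) _).mono_left nhdsWithin_le_nhds
    rw [sub_sub_cancel] at hlim
    refine ge_of_tendsto hlim ?_
    filter_upwards [Ioo_mem_nhdsLT (show (0 : ℝ) < 1 - 1 / √2 by linarith)] with p hp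
    exact hB (hmem p hp.1.le hp.2)

end Threshold

end

theorem mainTheorem2 {V : Type} [Fintype V] [DecidableEq V] (G : SimpleGraph V)
    [DecidableRel G.Adj] (hG : IsLocallyReconstructible G) :
    (∀ p ∈ Set.Icc (0 : ℝ) (1 / 2), (1 - p) ^ 2 < 1 / 2 → ¬ Purifiable G p) ∧
    (∀ p ∈ Set.Icc (0 : ℝ) (1 / 2), 1 / 2 < (1 - p) ^ 2 → DRPPPurifies G p) ∧
    IsLUB {p | p ∈ Set.Icc (0 : ℝ) (1 / 2) ∧ Purifiable G p} (1 - 1 / √2) ∧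
    IsLUB {p | p ∈ Set.Icc (0 : ℝ) (1 / 2) ∧ DRPPPurifies G p} (1 - 1 / √2) ∧
    (∀ p ∈ Set.Icc (0 : ℝ) (1 / 2), initialFidelity G p = (1 - p) ^ Fintype.card V) ∧
    fThreshold G = fCrit G ∧
    fCrit G = (2 : ℝ) ^ (-(Fintype.card V : ℝ) / 2) := by
  have hneg : ∀ p ∈ Set.Icc (0 : ℝ) (1 / 2), (1 - p) ^ 2 < 1 / 2 → ¬ Purifiable G p :=
    fun p hp h => not_purifiable hG hp.2 h
  have hpos : ∀ p ∈ Set.Icc (0 : ℝ) (1 / 2), 1 / 2 < (1 - p) ^ 2 → DRPPPurifies G p :=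
    fun p hp h => drppPurifies_of_half_lt G hp.1 (by linarith [hp.2]) h
  -- As the DRPP is an SLOCC protocol, impossibility passes to it, and its success passes to
  -- arbitrary protocols.
  have hneg' : ∀ p ∈ Set.Icc (0 : ℝ) (1 / 2), (1 - p) ^ 2 < 1 / 2 → ¬ DRPPPurifies G p :=
    fun p hp h hd => hneg p hp h (DRPPPurifies.purifiable G hd)
  have hpos' : ∀ p ∈ Set.Icc (0 : ℝ) (1 / 2), 1 / 2 < (1 - p) ^ 2 → Purifiable G p :=
    fun p hp h => DRPPPurifies.purifiable G (hpos p hp h)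
  have hcrit : fCrit G = (2 : ℝ) ^ (-(Fintype.card V : ℝ) / 2) := by
    unfold fCrit
    simp only [initialFidelity_eq]
    exact sInf_threshold hneg' hpos _
  have hthr : fThreshold G = (2 : ℝ) ^ (-(Fintype.card V : ℝ) / 2) := by
    unfold fThreshold
    simp only [initialFidelity_eq]
    exact sInf_threshold hneg hpos' _
  exact ⟨hneg, hpos, isLUB_threshold hneg hpos', isLUB_threshold hneg' hpos,
    fun p _ => initialFidelity_eq G p, hthr.trans hcrit.symm, hcrit⟩
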